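/- **Theorem 3.1.** Let $(b_j)_{j\ge 0}$ and $(w_i)_{i\ge 1}$ be real numbers with $b_j\ge 0$ for $j\ne 1$, $0<-b_1=\sum_{j\neq 1}b_j<\infty$, $b_0>0$, and $w_i>0$ for $i\ge 1$. Let $X=(X(t))_{t\ge 0}$ be a regular (non-explosive, càdlàg) weighted Markov branching process with $X(0)=1$, that is, a continuous-time Markov chain on $\mathbb Z_+$ with an honest standard transition function $(p_{ij}(t))$ satisfying $p_{ij}'(t)=\sum_k p_{ik}(t)q_{kj}$ for $i\ge 0$, $j\ge 1$, $t\ge 0$, where $q_{ij}=w_ib_{j-i+1}$ if $i\ge 1$ and $j\ge i-1$, and $q_{ij}=0$ otherwise. Let $\mathbb N\subset\mathbb Z_+$ be a finite set with $1\notin\mathbb N$ and $b_k>0$ for all $k\in\mathbb N$. Put $\tau=\inf\{t\ge 0: X(t)=0\}$, and for $k\in\mathbb N$ let $Y_k(\tau)$ be the $(k-1)$-range crossing number, i.e. the number of times $s\in(0,\tau]$ with $X(s)-X(s-)=k-1$. Write $$B(u)=\sum_{j\ge 0}b_ju^j,\qquad \bar B_{\mathbb N}(u)=\sum_{j\notin\mathbb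 N}b_ju^j,$$ and, for $v\in[0,1]^{\mathbb N}$ and $l\in\mathbb Z_+^{\mathbb N}$, $v^l=\prod_{k\in\mathbb N}v_k^{l_k}$ (with $0^0=1$) and $|l|=\sum_{k\in\mathbb N} l_k$; let $e_k$ be the $k$-th unit vector. Let $\rho$ be the minimal nonnegative root of $B(u)=0$. Then $\rho>0$, and there is a unique family $(\rho_l)_{l\in\mathbb Z_+^{\mathbb N}}$ such that $\rho_0$ is the minimal nonnegative root of $\bar B_{\mathbb N}(u)=0$ and, for every $l\neq 0$, $$\rho_{l}=-\frac{1}{\bar B_{\mathbb N}'(\rho_0)}\Bigg(\sum_{j\notin\mathbb N,\ j\ne 1}b_j\sum_{\substack{l^{(1)}+\cdots+l^{(j)}=l\\ |l^{(1)}|,\dots,|l^{(j)}|<|l|}}\rho_{l^{(1)}}\cdots\rho_{l^{(j)}}+\sum_{k\in\mathbb N,\ l_k\ge 1}b_k\,\rho^{*(k)}_{l-e_k}\Bigg),$$ where the series over $j$ converges and $\rho^{*(k)}_m=\sum_{m^{(1)}+\cdots+m^{(k)}=m}\rho_{m^{(1)}}\cdots\rho_{m^{(k)}}$ is the $k$-th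 convolution power ($\rho^{*(0)}_0=1$ and $\rho^{*(0)}_m=0$ for $m\ne0$). For this family, the joint probability generating function of $(Y_k(\tau))_{k\in\mathbb N}$ conditioned on $\tau<\infty$ is $$G(v)=\mathbb E\Big[\prod_{k\in\mathbb N}v_k^{Y_k(\tau)}\,\Big|\,\tau<\infty\Big]=\rho^{-1}\sum_{l\in\mathbb Z_+^{\mathbb N}}\rho_l v^l,\qquad v\in[0,1]^{\mathbb N},$$ where the series converges; equivalently, $P(Y(\tau)=l\mid\tau<\infty)=\rho_l/\rho$ for all $l\in\mathbb Z_+^{\mathbb N}$. -/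

import Mathlib

open scoped NNReal ENNReal Topology BigOperators
open MeasureTheory

noncomputable section

namespace WMB

/-- The standing assumptions on the offspring sequence `b` and the weights `w`:
`b j ≥ 0` for `j ≠ 1`, `0 < -b 1 = ∑_{j ≠ 1} b j < ∞`, and `w i > 0` for `i ≥ 1`. -/
structure IsBranchingData (b w : ℕ → ℝ) : Prop where
  nonneg : ∀ j, j ≠ 1 → 0 ≤ b j
  neg : b 1 < 0
  hasSum : HasSum (fun j => if j = 1 then 0 else b j) (-b 1)
  weight_pos : ∀ i, 1 ≤ i → 0 < w i

/-- The weighted branching `Q`-matrix: `q i j = w i * b (j - i + 1)` for `i ≥ 1`, `j ≥ i - 1`,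
and `0` otherwise. -/
def qMatrix (b w : ℕ → ℝ) (i j : ℕ) : ℝ :=
  if 1 ≤ i ∧ i ≤ j + 1 then w i * b (j + 1 - i) else 0

/-- `p t i j`, `t ≥ 0`, is an honest standard transition function on `ℕ = {0, 1, 2, …}`.
Only times `t ≥ 0` matter. -/
structure IsTransitionFunction (p : ℝ → ℕ → ℕ → ℝ) : Prop where
  nonneg : ∀ t, 0 ≤ t → ∀ i j, 0 ≤ p t i j
  hasSum_one : ∀ t, 0 ≤ t → ∀ i, HasSum (fun j => p t i j) 1
  zero : ∀ i j, p 0 i j = if i = j then 1 else 0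
  chapman_kolmogorov : ∀ s t, 0 ≤ s → 0 ≤ t → ∀ i j,
    HasSum (fun k => p s i k * p t k j) (p (s + t) i j)
  standard : ∀ i, Filter.Tendsto (fun t => p t i i) (𝓝[>] 0) (𝓝 1)

/-- The Kolmogorov forward equations `p'_{ij}(t) = ∑_k p_{ik}(t) q_{kj}` for `i ≥ 0`, `j ≥ 1`,
`t ≥ 0` (one-sided derivative at `t = 0`; for each `j` the sum has only finitely many
nonzero terms). -/
def ForwardEquation (b w : ℕ → ℝ) (p : ℝ → ℕ → ℕ → ℝ) : Prop :=
  ∀ i j, 1 ≤ j → ∀ t, 0 ≤ t →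
    HasDerivWithinAt (fun s => p s i j) (∑' k, p t i k * qMatrix b w k j) (Set.Ici 0) t

/-- `X` is a continuous-time Markov chain with transition function `p`
(through its finite-dimensional distributions, with an arbitrary initial law). -/
def IsMarkovChain {Ω : Type*} [MeasurableSpace Ω] (P : Measure Ω) (X : ℝ≥0 → Ω → ℕ)
    (p : ℝ → ℕ → ℕ → ℝ) : Prop :=
  ∀ (n : ℕ) (t : ℕ → ℝ≥0) (x : ℕ → ℕ), t 0 = 0 → Monotone t →
    P.real {ω | ∀ m ≤ n, X (t m) ω = x m} =
      P.real {ω | X 0 ω = x 0} *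
        ∏ m ∈ Finset.range n, p ((t (m + 1) : ℝ) - (t m : ℝ)) (x m) (x (m + 1))

/-- A path in the discrete space `ℕ` is right-continuous and has left limits in `ℕ` at all
times `t < ∞`.  In particular it has finitely many jumps on bounded intervals: no explosion. -/
def IsCadlagPath (x : ℝ≥0 → ℕ) : Prop :=
  ∀ t : ℝ≥0, (∀ᶠ s in 𝓝[>] t, x s = x t) ∧ ∃ i, ∀ᶠ s in 𝓝[<] t, x s = i

/-- `X` is a (regular) weighted Markov branching process with parameters `b`, `w`: a Markov chain
on `ℕ` whose transition function satisfies the forward equations of the weighted branching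
`Q`-matrix, with almost surely non-explosive càdlàg paths. -/
structure IsWMBP {Ω : Type*} [MeasurableSpace Ω] (P : Measure Ω) (b w : ℕ → ℝ)
    (X : ℝ≥0 → Ω → ℕ) : Prop where
  measurable : ∀ t, Measurable (X t)
  markov : ∃ p, IsTransitionFunction p ∧ ForwardEquation b w p ∧ IsMarkovChain P X p
  cadlag : ∀ᵐ ω ∂P, IsCadlagPath fun t => X t ω

/-- The path `x` has at time `s > 0` a jump of size `k - 1`, i.e. `x(s) - x(s-) = k - 1`. -/
def HasJump (x : ℝ≥0 → ℕ) (k : ℕ) (s : ℝ≥0) : Prop :=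
  0 < s ∧ ∃ i, (∀ᶠ r in 𝓝[<] s, x r = i) ∧ x s + 1 = i + k

/-- The `(k - 1)`-range crossing number up to time `T ∈ [0, ∞]`: the number of jumps of size
`k - 1` in `(0, T]`.  (The set is finite for a càdlàg path, `T < ∞` and `k ≠ 1`.) -/
def crossingNumber (x : ℝ≥0 → ℕ) (k : ℕ) (T : ℝ≥0∞) : ℕ :=
  Set.ncard {s : ℝ≥0 | (s : ℝ≥0∞) ≤ T ∧ HasJump x k s}

/-- The extinction time `inf {t ≥ 0 : x t = 0} ∈ [0, ∞]`. -/
def extinctionTime (x : ℝ≥0 → ℕ) : ℝ≥0∞ :=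
  ⨅ (t : ℝ≥0) (_ : x t = 0), (t : ℝ≥0∞)

/-- `u` is the minimal nonnegative root of the power series `∑ j, c j * u ^ j`. -/
def IsMinRoot (c : ℕ → ℝ) (u : ℝ) : Prop :=
  IsLeast {y : ℝ | 0 ≤ y ∧ HasSum (fun j => c j * y ^ j) 0} u

/-- The coefficients of `B̄_S(u) = ∑_{j ∉ S} b j * u ^ j`. -/
def offCoeff (b : ℕ → ℝ) (S : Finset ℕ) (j : ℕ) : ℝ := if j ∈ S then 0 else b j

/-- `B̄_S(u) = ∑_{j ∉ S} b j * u ^ j`. -/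
def Bbar (b : ℕ → ℝ) (S : Finset ℕ) (u : ℝ) : ℝ := ∑' j, offCoeff b S j * u ^ j

variable {S : Finset ℕ}

/-- The `j`-tuples of multi-indices with sum `l`. -/
def tuples (j : ℕ) (l : S → ℕ) : Finset (Fin j → S → ℕ) :=
  (Fintype.piFinset fun _ : Fin j => Finset.Iic l).filter fun f => ∑ i, f i = l

/-- The `j`-th convolution power `r^{*(j)}_l`. -/
def conv (r : (S → ℕ) → ℝ) (j : ℕ) (l : S → ℕ) : ℝ :=
  ∑ f ∈ tuples j l, ∏ i, r (f i)

/-- The part of `r^{*(j)}_l` in which all multi-indices of the tuple have smaller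
total degree than `l`. -/
def convLower (r : (S → ℕ) → ℝ) (j : ℕ) (l : S → ℕ) : ℝ :=
  ∑ f ∈ (tuples j l).filter (fun f => ∀ i, ∑ k, f i k < ∑ k, l k), ∏ i, r (f i)

/-- `r l`, `l ∈ ℕ^S`, are the coefficients given by the recursion: `r 0` is the minimal nonnegative
root of `B̄_S`, and for `l ≠ 0`
`r l = -(∑_{j ∉ S, j ≠ 1} b j * convLower r j l + ∑_{k ∈ S, l k ≥ 1} b k * r^{*(k)}_{l - e_k})
  / B̄_S'(r 0)`,
the series being convergent. -/
structure IsCrossingCoeff (b : ℕ → ℝ) (r : (S → ℕ) → ℝ) : Prop where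
  zero : IsMinRoot (offCoeff b S) (r 0)
  summable : ∀ l, l ≠ 0 →
    Summable fun j => if j = 1 then 0 else offCoeff b S j * convLower r j l
  recursion : ∀ l, l ≠ 0 →
    r l = -((∑' j, if j = 1 then 0 else offCoeff b S j * convLower r j l) +
        ∑ k : S, if 1 ≤ l k then b k * conv r k (l - Pi.single k 1) else 0) /
      deriv (Bbar b S) (r 0)

end WMB

end

/-!
Only the embedded jump chain of `X` matters: from a state `i ≥ 1` it moves to `i + j - 1` with
probability `b j / -b 1`, `j ≠ 1`, whatever the weights `w` are.

*Coefficients.* Let `crossWeight b S l` be the total probability of the jump sequences from `1` to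
`0` with crossing numbers `l`. The walk moves down by unit steps only, so a path from `i + i'` to
`0` splits into independent paths from `i + i'` down to `i'` and from `i'` down to `0`
(`hitTotal_add`); hence the weights from `j` are the `j`-th convolution power of those from `1`, and
the first-step decomposition (`crossWeight_eq`) is a convolution equation for `crossWeight`. Solving
it for the terms that contain the coefficient of full degree (`conv_eq_convLower_add`) gives the
recursion, `isCrossingCoeff_crossWeight`; the division is legitimate since
`B̄_S'(r 0) < 0`, by convexity and `B̄_S(1) < 0`. That the total mass and the coefficient at `0` are
minimal roots is the minimality of hitting probabilities among the nonnegative solutions of their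
equation (`tsum_hitTotal_le`, `hitTotal_zero_le`).

*Probability.* The law of the jump chain is obtained from the skeletons `X (m * h)`, `h → 0`. The
probability that a skeleton with mesh `h` runs through a given list of states is at most the product
of the factors `p h x y / (1 - p h x x)` (`measure_exists_skelEvent_le`), and by the forward
equations at time `0` these factors tend to `b (y - x + 1) / -b 1` if `y ≥ 1`, while for `y = 0` the
total mass gives the bound from above (`eventually_skelStep_le`). Fine skeletons reproduce the jump
history of a right-continuous path (`JumpHist.eventually_skelHist`), so each history, stopped at `0`
and after `n` jumps, has at most the probability that the jump chain gives to it. These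
probabilities sum to `1`, and almost surely the stopped history exists, because the process leaves
every state `y ≥ 1` (`ae_not_stuck`); so the bounds are equalities (`measure_fineEvent_eq`). Finally
a càdlàg path that reaches `0` does so after finitely many jumps
(`IsCadlagPath.exists_jumpHist`), whence `measure_extinct_crossing`.
-/

namespace WMB

/-! ### Shifts and convolution of `[0, ∞]`-valued families of multi-indices -/

section Convolution

variable {ι : Type*}

/-- The family `f` translated by `m`: the coefficients of `v ^ m * ∑ l, f l * v ^ l`. -/
noncomputable def shift (m : ι → ℕ) (f : (ι → ℕ) → ℝ≥0∞) (l : ι → ℕ) : ℝ≥0∞ :=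
  open Classical in if m ≤ l then f (l - m) else 0

/-- The convolution of two families of multi-indices, as a sum over all multi-indices; the shift
restricts it to `a ≤ l`. -/
noncomputable def cmul (f g : (ι → ℕ) → ℝ≥0∞) (l : ι → ℕ) : ℝ≥0∞ :=
  ∑' a, f a * shift a g l

/-- The unit of the convolution. -/
noncomputable def unitCoeff (l : ι → ℕ) : ℝ≥0∞ := open Classical in if l = 0 then 1 else 0

@[simp] lemma shift_zero (f : (ι → ℕ) → ℝ≥0∞) : shift 0 f = f := by
  funext l; simp [shift]

lemma shift_mono (m : ι → ℕ) {f g : (ι → ℕ) → ℝ≥0∞} (h : f ≤ g) : shift m f ≤ shift m g := by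
  intro l; unfold shift; split_ifs
  · exact h _
  · exact le_rfl

lemma shift_add (m a : ι → ℕ) (f : (ι → ℕ) → ℝ≥0∞) : shift (m + a) f = shift m (shift a f) := by
  classical
  funext l
  unfold shift
  by_cases h : m + a ≤ l
  · have h1 : m ≤ l := (le_add_of_nonneg_right (zero_le)).trans h
    have h2 : a ≤ l - m := by
      intro i; have := h i; simp only [Pi.add_apply, Pi.sub_apply] at *; omega
    rw [if_pos h, if_pos h1, if_pos h2]
    congr 1; funext i; simp only [Pi.add_apply, Pi.sub_apply]; omega
  · rw [if_neg h]
    by_cases h1 : m ≤ l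
    · rw [if_pos h1, if_neg]
      intro h2; apply h; intro i
      have := h1 i; have := h2 i; simp only [Pi.add_apply, Pi.sub_apply] at *; omega
    · rw [if_neg h1]

lemma tsum_shift_mul (m : ι → ℕ) (f k : (ι → ℕ) → ℝ≥0∞) :
    ∑' a, shift m f a * k a = ∑' a, f a * k (m + a) := by
  classical
  have hinj : Function.Injective fun a : ι → ℕ => m + a := add_right_injective m
  rw [← hinj.tsum_eq (f := fun a => shift m f a * k a)]
  · refine tsum_congr fun a => ?_
    have : m ≤ m + a := le_add_of_nonneg_right zero_le
    simp only [shift, if_pos this]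
    congr 2; funext i; simp
  · intro l hl
    have h : m ≤ l := by
      by_contra h
      exact hl (by simp [shift, h])
    exact ⟨l - m, by
      funext i
      have h2 : m i ≤ l i := h i
      simp only [Pi.add_apply, Pi.sub_apply]; omega⟩

lemma tsum_shift (m : ι → ℕ) (f : (ι → ℕ) → ℝ≥0∞) : ∑' l, shift m f l = ∑' l, f l := by
  simpa using tsum_shift_mul m f (fun _ => 1)

lemma shift_tsum {κ : Type*} (m : ι → ℕ) (f : κ → (ι → ℕ) → ℝ≥0∞) (l : ι → ℕ) :
    shift m (fun l => ∑' j, f j l) l = ∑' j, shift m (f j) l := by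
  unfold shift; split_ifs <;> simp

lemma shift_const_mul (m : ι → ℕ) (c : ℝ≥0∞) (f : (ι → ℕ) → ℝ≥0∞) (l : ι → ℕ) :
    shift m (fun l => c * f l) l = c * shift m f l := by
  unfold shift; split_ifs <;> simp

lemma cmul_shift (m : ι → ℕ) (f g : (ι → ℕ) → ℝ≥0∞) :
    cmul (shift m f) g = shift m (cmul f g) := by
  funext l
  unfold cmul
  rw [tsum_shift_mul m f (fun a => shift a g l), shift_tsum]
  refine tsum_congr fun a => ?_
  rw [shift_const_mul, ← shift_add]

lemma cmul_unit (g : (ι → ℕ) → ℝ≥0∞) : cmul unitCoeff g = g := by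
  classical
  funext l
  unfold cmul
  rw [tsum_eq_single 0]
  · simp [unitCoeff]
  · intro a ha; simp [unitCoeff, ha]

lemma cmul_tsum {κ : Type*} (c : κ → ℝ≥0∞) (f : κ → (ι → ℕ) → ℝ≥0∞) (g : (ι → ℕ) → ℝ≥0∞)
    (l : ι → ℕ) :
    cmul (fun l => ∑' j, c j * f j l) g l = ∑' j, c j * cmul (f j) g l := by
  unfold cmul
  simp_rw [← ENNReal.tsum_mul_right, ← ENNReal.tsum_mul_left]
  rw [ENNReal.tsum_comm]
  simp_rw [mul_assoc]

lemma tsum_cmul (f g : (ι → ℕ) → ℝ≥0∞) : ∑' l, cmul f g l = (∑' l, f l) * ∑' l, g l := by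
  unfold cmul
  rw [ENNReal.tsum_comm]
  simp_rw [ENNReal.tsum_mul_left, tsum_shift, ENNReal.tsum_mul_right]

lemma cmul_apply_zero (f g : (ι → ℕ) → ℝ≥0∞) : cmul f g 0 = f 0 * g 0 := by
  classical
  unfold cmul
  rw [tsum_eq_single 0]
  · simp
  · intro a ha
    have : ¬ a ≤ 0 := fun h => ha (le_antisymm h zero_le)
    simp [shift, this]

/-- Monotone convergence for sums. -/
lemma tsum_iSup_of_monotone {α : Type*} (f : ℕ → α → ℝ≥0∞) (hf : Monotone f) :
    ∑' a, ⨆ n, f n a = ⨆ n, ∑' a, f n a := by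
  let _ : MeasurableSpace α := ⊤
  simp_rw [← lintegral_count]
  exact lintegral_iSup (fun n => measurable_from_top) hf

end Convolution

/-! ### Hitting weights of a skip-free walk -/

section HitWeight

variable {ι : Type*} (q : ℕ → ℝ≥0∞) (mk : ℕ → ι → ℕ)

/-- The walk from `i` moves by `j - 1` with weight `q j`, a move of size `j - 1` carrying the mark
`mk j`. `hitWeight q mk n i l` is the total weight of the paths from `i` that hit `0` for the first
time within `n` moves, with marks of sum `l`. -/
noncomputable def hitWeight : ℕ → ℕ → (ι → ℕ) → ℝ≥0∞
  | _, 0 => unitCoeff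
  | 0, _ + 1 => 0
  | n + 1, i + 1 => fun l => ∑' j, q j * shift (mk j) (hitWeight n (i + j)) l

/-- The total weight of the paths from `i` to the first hit of `0` with marks of sum `l`. -/
noncomputable def hitTotal (i : ℕ) (l : ι → ℕ) : ℝ≥0∞ := ⨆ n, hitWeight q mk n i l

lemma hitWeight_at_zero (n : ℕ) : hitWeight q mk n 0 = unitCoeff := by
  cases n <;> rfl

lemma hitWeight_succ (n i : ℕ) (l : ι → ℕ) : hitWeight q mk (n + 1) (i + 1) l =
    ∑' j, q j * shift (mk j) (hitWeight q mk n (i + j)) l := rfl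

lemma hitWeight_le_succ (n i : ℕ) : hitWeight q mk n i ≤ hitWeight q mk (n + 1) i := by
  induction n generalizing i with
  | zero => cases i with
    | zero => simp [hitWeight_at_zero]
    | succ i => intro l; simp [hitWeight]
  | succ n ih => cases i with
    | zero => simp [hitWeight_at_zero]
    | succ i =>
      intro l
      rw [hitWeight_succ, hitWeight_succ]
      exact ENNReal.tsum_le_tsum fun j => mul_le_mul_right (shift_mono _ (ih _) l) _

lemma hitWeight_mono (i : ℕ) : Monotone fun n => hitWeight q mk n i :=
  monotone_nat_of_le_succ fun n => hitWeight_le_succ q mk n i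

lemma hitWeight_le_total (n i : ℕ) : hitWeight q mk n i ≤ hitTotal q mk i :=
  fun l => le_iSup (fun n => hitWeight q mk n i l) n

lemma hitTotal_at_zero : hitTotal q mk 0 = unitCoeff := by
  funext l; simp [hitTotal, hitWeight_at_zero]

lemma shift_hitTotal (m : ι → ℕ) (i : ℕ) (l : ι → ℕ) :
    shift m (hitTotal q mk i) l = ⨆ n, shift m (hitWeight q mk n i) l := by
  unfold shift; split_ifs
  · rfl
  · simp

/-- First-step decomposition. -/
lemma hitTotal_succ (i : ℕ) (l : ι → ℕ) : hitTotal q mk (i + 1) l =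
    ∑' j, q j * shift (mk j) (hitTotal q mk (i + j)) l := by
  simp_rw [shift_hitTotal, ENNReal.mul_iSup]
  rw [tsum_iSup_of_monotone]
  · refine le_antisymm (iSup_le fun n => ?_) (iSup_le fun n => ?_)
    · cases n with
      | zero => simp [hitWeight]
      | succ n => exact le_iSup (fun n => ∑' j, q j * shift (mk j) (hitWeight q mk n (i + j)) l) n
    · exact le_iSup (fun n => hitWeight q mk n (i + 1) l) (n + 1)
  · intro n n' h j
    exact mul_le_mul_right (shift_mono _ (hitWeight_mono q mk _ h) l) _

lemma cmul_hitWeight_le (n i i' : ℕ) :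
    cmul (hitWeight q mk n i) (hitTotal q mk i') ≤ hitTotal q mk (i + i') := by
  induction n generalizing i with
  | zero => cases i with
    | zero => simp [hitWeight_at_zero, cmul_unit]
    | succ i => intro l; simp [hitWeight, cmul]
  | succ n ih => cases i with
    | zero => simp [hitWeight_at_zero, cmul_unit]
    | succ i =>
      intro l
      have h : hitWeight q mk (n + 1) (i + 1) = fun l =>
        ∑' j, q j * shift (mk j) (hitWeight q mk n (i + j)) l := rfl
      rw [h, cmul_tsum, show i + 1 + i' = (i + i') + 1 by ring, hitTotal_succ]
      refine ENNReal.tsum_le_tsum fun j => mul_le_mul_right ?_ _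
      rw [cmul_shift, show i + i' + j = i + j + i' by ring]
      exact shift_mono _ (ih _) l

lemma hitWeight_le_cmul (n i i' : ℕ) :
    hitWeight q mk n (i + i') ≤ cmul (hitTotal q mk i) (hitTotal q mk i') := by
  induction n generalizing i with
  | zero => cases i with
    | zero => simpa [hitTotal_at_zero, cmul_unit] using hitWeight_le_total q mk 0 i'
    | succ i =>
      intro l; rw [show i + 1 + i' = (i + i') + 1 by ring]; simp [hitWeight]
  | succ n ih => cases i with
    | zero => simpa [hitTotal_at_zero, cmul_unit] using hitWeight_le_total q mk (n + 1) i'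
    | succ i =>
      intro l
      have h : hitTotal q mk (i + 1) = fun l =>
        ∑' j, q j * shift (mk j) (hitTotal q mk (i + j)) l := funext (hitTotal_succ q mk i)
      rw [h, cmul_tsum, show i + 1 + i' = (i + i') + 1 by ring, hitWeight_succ]
      refine ENNReal.tsum_le_tsum fun j => mul_le_mul_right ?_ _
      rw [cmul_shift, show i + i' + j = i + j + i' by ring]
      exact shift_mono _ (ih _) l

/-- Since the walk moves down by unit steps, a path from `i + i'` to `0` is a path down to `i'`
followed by a path from `i'` to `0`. -/
lemma hitTotal_add (i i' : ℕ) :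
    hitTotal q mk (i + i') = cmul (hitTotal q mk i) (hitTotal q mk i') := by
  refine le_antisymm (fun l => iSup_le fun n => hitWeight_le_cmul q mk n i i' l) fun l => ?_
  unfold cmul
  have : ∀ a, hitTotal q mk i a * shift a (hitTotal q mk i') l =
      ⨆ n, hitWeight q mk n i a * shift a (hitTotal q mk i') l := fun a => by
    rw [hitTotal, ENNReal.iSup_mul]
  simp_rw [this]
  rw [tsum_iSup_of_monotone]
  · exact iSup_le fun n => cmul_hitWeight_le q mk n i i' l
  · intro n n' h a
    exact mul_le_mul_left (hitWeight_mono q mk i h a) _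

/-- The total masses of the hitting weights are geometric in the starting point. -/
lemma tsum_hitTotal (i : ℕ) : ∑' l, hitTotal q mk i l = (∑' l, hitTotal q mk 1 l) ^ i := by
  classical
  induction i with
  | zero => rw [hitTotal_at_zero]; simp [unitCoeff]
  | succ i ih => rw [add_comm, hitTotal_add, tsum_cmul, ih, pow_add, pow_one]

lemma hitTotal_apply_zero (i : ℕ) : hitTotal q mk i 0 = (hitTotal q mk 1 0) ^ i := by
  classical
  induction i with
  | zero => rw [hitTotal_at_zero]; simp [unitCoeff]
  | succ i ih => rw [add_comm, hitTotal_add, cmul_apply_zero, ih, pow_add, pow_one]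

/-- The total weight is a fixed point of the generating function of the move weights. -/
lemma tsum_hitTotal_fixed :
    ∑' l, hitTotal q mk 1 l = ∑' j, q j * (∑' l, hitTotal q mk 1 l) ^ j := by
  calc ∑' l, hitTotal q mk 1 l
      = ∑' l, ∑' j, q j * shift (mk j) (hitTotal q mk (0 + j)) l :=
        tsum_congr (hitTotal_succ q mk 0)
    _ = _ := by
      rw [ENNReal.tsum_comm]
      refine tsum_congr fun j => ?_
      rw [ENNReal.tsum_mul_left, tsum_shift, zero_add, tsum_hitTotal]

/-- The total weight is bounded by every fixed point. -/
lemma tsum_hitTotal_le {y : ℝ≥0∞} (hy : ∑' j, q j * y ^ j ≤ y) :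
    ∑' l, hitTotal q mk 1 l ≤ y := by
  classical
  have key : ∀ n i, ∑' l, hitWeight q mk n i l ≤ y ^ i := by
    intro n
    induction n with
    | zero =>
      intro i; cases i with
      | zero => rw [hitWeight_at_zero]; simp [unitCoeff]
      | succ i => simp [hitWeight]
    | succ n ih =>
      intro i; cases i with
      | zero => rw [hitWeight_at_zero]; simp [unitCoeff]
      | succ i =>
        simp_rw [hitWeight_succ]
        rw [ENNReal.tsum_comm]
        simp_rw [ENNReal.tsum_mul_left, tsum_shift]
        calc ∑' j, q j * ∑' l, hitWeight q mk n (i + j) l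
            ≤ ∑' j, y ^ i * (q j * y ^ j) := ENNReal.tsum_le_tsum fun j => by
              calc q j * ∑' l, hitWeight q mk n (i + j) l ≤ q j * y ^ (i + j) := by
                    gcongr; exact ih _
                _ = _ := by ring
          _ ≤ y ^ (i + 1) := by
            rw [ENNReal.tsum_mul_left, pow_succ]; gcongr
  unfold hitTotal
  rw [tsum_iSup_of_monotone _ (hitWeight_mono q mk 1)]
  exact iSup_le fun n => by simpa using key n 1

/-- The weight of the paths without marks is a fixed point of the generating function of the
unmarked moves. -/
lemma hitTotal_zero_fixed [∀ j, Decidable (mk j = 0)] : hitTotal q mk 1 0 =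
    ∑' j, (if mk j = 0 then q j else 0) * (hitTotal q mk 1 0) ^ j := by
  classical
  conv_lhs => rw [show (1 : ℕ) = 0 + 1 from rfl, hitTotal_succ]
  refine tsum_congr fun j => ?_
  rw [← hitTotal_apply_zero, zero_add]
  by_cases h : mk j = 0
  · simp [h]
  · have : ¬ mk j ≤ 0 := fun h' => h (le_antisymm h' zero_le)
    simp [h, shift, this]

/-- The weight of the paths without marks is bounded by every such fixed point. -/
lemma hitTotal_zero_le [∀ j, Decidable (mk j = 0)] {y : ℝ≥0∞}
    (hy : ∑' j, (if mk j = 0 then q j else 0) * y ^ j ≤ y) :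
    hitTotal q mk 1 0 ≤ y := by
  classical
  have key : ∀ n i, hitWeight q mk n i 0 ≤ y ^ i := by
    intro n
    induction n with
    | zero =>
      intro i; cases i with
      | zero => rw [hitWeight_at_zero]; simp [unitCoeff]
      | succ i => simp [hitWeight]
    | succ n ih =>
      intro i; cases i with
      | zero => rw [hitWeight_at_zero]; simp [unitCoeff]
      | succ i =>
        rw [hitWeight_succ]
        calc ∑' j, q j * shift (mk j) (hitWeight q mk n (i + j)) 0
            ≤ ∑' j, y ^ i * ((if mk j = 0 then q j else 0) * y ^ j) :=
              ENNReal.tsum_le_tsum fun j => by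
              by_cases h : mk j = 0
              · rw [if_pos h, h, shift_zero]
                calc q j * hitWeight q mk n (i + j) 0 ≤ q j * y ^ (i + j) := by
                      gcongr; exact ih _
                  _ = _ := by ring
              · have : ¬ mk j ≤ 0 := fun h' => h (le_antisymm h' zero_le)
                simp [h, shift, this]
          _ ≤ y ^ (i + 1) := by
            rw [ENNReal.tsum_mul_left, pow_succ]; gcongr
  exact iSup_le fun n => by simpa using key n 1

end HitWeight

/-! ### Convolution powers as sums over tuples -/

section Tuples

variable {S : Finset ℕ}

lemma mem_tuples {j : ℕ} {l : S → ℕ} {f : Fin j → S → ℕ} : f ∈ tuples j l ↔ ∑ i, f i = l := by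
  unfold tuples
  simp only [Finset.mem_filter, Fintype.mem_piFinset, Finset.mem_Iic, and_iff_right_iff_imp]
  rintro rfl i
  exact Finset.single_le_sum (f := f) (fun _ _ => zero_le) (Finset.mem_univ i)

lemma conv_zero (r : (S → ℕ) → ℝ) (l : S → ℕ) : conv r 0 l = if l = 0 then 1 else 0 := by
  unfold conv
  split_ifs with h
  · subst h
    rw [Finset.sum_eq_single_of_mem (fun i => i.elim0) (by simp [mem_tuples])]
    · simp
    · intro f _ hf; exact absurd (Subsingleton.elim _ _) hf
  · rw [Finset.sum_eq_zero]
    intro f hf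
    rw [mem_tuples] at hf
    exact absurd (by simpa using hf.symm) h

lemma conv_succ (r : (S → ℕ) → ℝ) (j : ℕ) (l : S → ℕ) :
    conv r (j + 1) l = ∑ a ∈ Finset.Iic l, r a * conv r j (l - a) := by
  unfold conv
  simp_rw [Finset.mul_sum]
  rw [Finset.sum_sigma']
  refine Finset.sum_bij' (fun f _ => ⟨f 0, Fin.tail f⟩) (fun p _ => Fin.cons p.1 p.2) ?_ ?_ ?_ ?_ ?_
  · intro f hf
    rw [mem_tuples, Fin.sum_univ_succ] at hf
    simp only [Finset.mem_sigma, Finset.mem_Iic, mem_tuples]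
    subst hf
    refine ⟨le_add_of_nonneg_right zero_le, ?_⟩
    rw [add_tsub_cancel_left]; rfl
  · rintro ⟨a, f⟩ h
    simp only [Finset.mem_sigma, Finset.mem_Iic, mem_tuples] at h
    rw [mem_tuples, Fin.sum_univ_succ]
    simp only [Fin.cons_zero, Fin.cons_succ]
    rw [h.2]
    exact add_tsub_cancel_of_le h.1
  · intro f _; simp
  · rintro ⟨a, f⟩ _; simp
  · intro f _; rw [Fin.prod_univ_succ]; rfl

/-- A tuple with sum `l` has an entry of full degree only if that entry is `l` and all the others
vanish. -/
lemma conv_eq_convLower_add (r : (S → ℕ) → ℝ) (j : ℕ) {l : S → ℕ} (hl : l ≠ 0) :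
    conv r j l = convLower r j l + j * r 0 ^ (j - 1) * r l := by
  unfold conv convLower
  rw [← Finset.sum_filter_add_sum_filter_not (tuples j l) (fun f => ∀ i, ∑ k, f i k < ∑ k, l k)]
  congr 1
  have hset : (tuples j l).filter (fun f => ¬ ∀ i, ∑ k, f i k < ∑ k, l k) =
      Finset.univ.image (fun i : Fin j => (Pi.single i l : Fin j → S → ℕ)) := by
    ext f
    simp only [Finset.mem_filter, mem_tuples, not_forall, not_lt, Finset.mem_image,
      Finset.mem_univ, true_and]
    constructor
    · rintro ⟨hf, i, hi⟩
      refine ⟨i, ?_⟩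
      have hle : ∀ k, f i k ≤ l k := fun k => by
        have := Finset.single_le_sum (f := fun i => f i k) (fun _ _ => zero_le)
          (Finset.mem_univ i)
        rw [← hf, Finset.sum_apply]; exact this
      have heq : f i = l := by
        funext k
        exact ((Finset.sum_eq_sum_iff_of_le (fun k _ => hle k)).1
          (le_antisymm (Finset.sum_le_sum fun k _ => hle k) hi)) k (Finset.mem_univ k)
      have hrest : ∑ i' ∈ Finset.univ.erase i, f i' = 0 := by
        rw [← Finset.add_sum_erase _ _ (Finset.mem_univ i), heq] at hf
        exact add_eq_left.1 hf
      funext i'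
      by_cases h : i' = i
      · subst h; simp [heq]
      · rw [Pi.single_eq_of_ne h]
        exact (((Finset.sum_eq_zero_iff_of_nonneg (fun _ _ => zero_le)).1 hrest) i'
          (by simp [h])).symm
    · rintro ⟨i, rfl⟩
      refine ⟨by simp, i, by simp⟩
  rw [hset, Finset.sum_image]
  · have : ∀ i : Fin j, ∏ i', r ((Pi.single i l : Fin j → S → ℕ) i') = r 0 ^ (j - 1) * r l := by
      intro i
      rw [← Finset.mul_prod_erase _ _ (Finset.mem_univ i), Pi.single_eq_same, mul_comm]
      congr 1
      rw [Finset.prod_congr rfl (g := fun _ => r 0)]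
      · simp
      · intro i' hi'; rw [Pi.single_eq_of_ne (Finset.ne_of_mem_erase hi')]
    rw [Finset.sum_congr rfl fun i _ => this i]
    simp [mul_assoc]
  · intro i _ i' _ h
    by_contra hne
    have := congrFun h i
    simp only [Pi.single_eq_same] at this
    rw [Pi.single_eq_of_ne hne] at this
    exact hl this

lemma cmul_eq_sum (f g : (S → ℕ) → ℝ≥0∞) (l : S → ℕ) :
    cmul f g l = ∑ a ∈ Finset.Iic l, f a * g (l - a) := by
  unfold cmul
  rw [tsum_eq_sum (s := Finset.Iic l)]
  · refine Finset.sum_congr rfl fun a ha => ?_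
    rw [Finset.mem_Iic] at ha
    simp [shift, ha]
  · intro a ha
    rw [Finset.mem_Iic] at ha
    simp [shift, ha]

/-- The hitting weights from `j` are the `j`-th convolution power of those from `1`. -/
lemma conv_toReal (q : ℕ → ℝ≥0∞) (mk : ℕ → S → ℕ) (j : ℕ) (l : S → ℕ)
    (hfin : ∀ i l, hitTotal q mk i l ≠ ∞) :
    conv (fun l => (hitTotal q mk 1 l).toReal) j l = (hitTotal q mk j l).toReal := by
  induction j generalizing l with
  | zero =>
    rw [conv_zero, hitTotal_at_zero]
    unfold unitCoeff; split_ifs <;> simp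
  | succ j ih =>
    rw [conv_succ, add_comm, hitTotal_add, cmul_eq_sum,
      ENNReal.toReal_sum fun a _ => ENNReal.mul_ne_top (hfin _ _) (hfin _ _)]
    exact Finset.sum_congr rfl fun a _ => by rw [ih, ENNReal.toReal_mul]

end Tuples

/-! ### The offspring law and the minimal roots -/

/-- The law of the embedded jump chain: a jump of size `j - 1` has probability `b j / -b 1`. -/
noncomputable def jumpLaw (b : ℕ → ℝ) (j : ℕ) : ℝ≥0∞ :=
  if j = 1 then 0 else ENNReal.ofReal (b j / -b 1)

/-- The mark of a jump of size `j - 1`: the unit vector `e_j` if `j ∈ S`, else `0`. -/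
def mark (S : Finset ℕ) (j : ℕ) : S → ℕ := fun k => if (k : ℕ) = j then 1 else 0

lemma mark_eq_zero {S : Finset ℕ} {j : ℕ} : mark S j = 0 ↔ j ∉ S := by
  constructor
  · intro h hj
    have := congrFun h ⟨j, hj⟩
    simp [mark] at this
  · intro h; funext k
    have : (k : ℕ) ≠ j := fun hk => h (hk ▸ k.2)
    simp [mark, this]

lemma mark_coe {S : Finset ℕ} (k : S) : mark S k = Pi.single k 1 := by
  funext k'
  simp only [mark, Pi.single_apply, Subtype.ext_iff]

lemma mark_coe_le {S : Finset ℕ} (k : S) (l : S → ℕ) : mark S k ≤ l ↔ 1 ≤ l k := by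
  constructor
  · intro h; simpa [mark] using h k
  · intro h k'
    by_cases hk : (k' : ℕ) = k
    · rw [Subtype.ext hk]; simpa [mark] using h
    · simp [mark, hk]

lemma jumpLaw_mul_pow {d : ℕ → ℝ} (hd : ∀ j, j ≠ 1 → 0 ≤ d j) (hd1 : d 1 < 0) {y : ℝ}
    (hy : 0 ≤ y) (j : ℕ) : jumpLaw d j * ENNReal.ofReal y ^ j =
      ENNReal.ofReal ((if j = 1 then 0 else d j / -d 1) * y ^ j) := by
  unfold jumpLaw
  split_ifs with h
  · simp
  · rw [ENNReal.ofReal_mul (div_nonneg (hd j h) (by linarith)), ENNReal.ofReal_pow hy]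

/-- The roots of the power series are the fixed points of the jump generating function. -/
lemma hasSum_zero_iff_fixed {d : ℕ → ℝ} (hd : ∀ j, j ≠ 1 → 0 ≤ d j) (hd1 : d 1 < 0) {y : ℝ}
    (hy : 0 ≤ y) : HasSum (fun j => d j * y ^ j) 0 ↔
      ∑' j, jumpLaw d j * ENNReal.ofReal y ^ j = ENNReal.ofReal y := by
  simp_rw [jumpLaw_mul_pow hd hd1 hy]
  set g : ℕ → ℝ := fun j => (if j = 1 then 0 else d j / -d 1) * y ^ j with hg
  have hg0 : ∀ j, 0 ≤ g j := fun j => by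
    simp only [hg]; split_ifs with h
    · simp
    · exact mul_nonneg (div_nonneg (hd j h) (by linarith)) (pow_nonneg hy j)
  have hsplit : (fun j => d j * y ^ j) = fun j => -d 1 * (g j - if j = 1 then y else 0) := by
    funext j
    by_cases h : j = 1
    · simp [hg, h]
    · simp only [hg, h, if_false]; field_simp [hd1.ne]; ring
  have hone : HasSum (fun j : ℕ => if j = 1 then y else 0) y := hasSum_ite_eq 1 y
  have h1 : HasSum (fun j => d j * y ^ j) 0 ↔ HasSum g y := by
    rw [hsplit]
    constructor
    · intro h
      have h2 := (h.mul_left (-d 1)⁻¹).add hone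
      have hne : -d 1 ≠ 0 := by linarith
      simpa only [inv_mul_cancel_left₀ hne, sub_add_cancel, mul_zero, zero_add] using h2
    · intro h
      simpa using (h.sub hone).mul_left (-d 1)
  rw [h1]
  constructor
  · intro h
    rw [← ENNReal.ofReal_tsum_of_nonneg hg0 h.summable, h.tsum_eq]
  · intro h
    have h2 : ∑' j, ENNReal.ofReal (g j) ≠ ∞ := by rw [h]; exact ENNReal.ofReal_ne_top
    have h3 := ENNReal.hasSum_toReal h2
    simp_rw [ENNReal.toReal_ofReal (hg0 _)] at h3
    have h4 : ∑' j, g j = y := by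
      have := ENNReal.ofReal_tsum_of_nonneg hg0 h3.summable
      rw [h] at this
      rwa [ENNReal.ofReal_eq_ofReal_iff (tsum_nonneg hg0) hy] at this
    rwa [h4] at h3

lemma isMinRoot_of_fixed {d : ℕ → ℝ} (hd : ∀ j, j ≠ 1 → 0 ≤ d j) (hd1 : d 1 < 0) {c : ℝ≥0∞}
    (hc : c ≠ ∞) (hfix : ∑' j, jumpLaw d j * c ^ j = c)
    (hmin : ∀ y, ∑' j, jumpLaw d j * y ^ j ≤ y → c ≤ y) : IsMinRoot d c.toReal := by
  refine ⟨⟨ENNReal.toReal_nonneg, ?_⟩, ?_⟩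
  · rw [hasSum_zero_iff_fixed hd hd1 ENNReal.toReal_nonneg, ENNReal.ofReal_toReal hc, hfix]
  · rintro y ⟨hy, hs⟩
    rw [hasSum_zero_iff_fixed hd hd1 hy] at hs
    exact ENNReal.toReal_le_of_le_ofReal hy (hmin _ hs.le)

section Crossing

variable {b w : ℕ → ℝ} {S : Finset ℕ}

/-- The total weight of the jump sequences from `1` to `0` with crossing numbers `l`. -/
noncomputable def crossWeight (b : ℕ → ℝ) (S : Finset ℕ) : (S → ℕ) → ℝ≥0∞ :=
  hitTotal (jumpLaw b) (mark S) 1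

lemma jumpLaw_tsum (hbw : IsBranchingData b w) : ∑' j, jumpLaw b j = 1 := by
  have h := (hbw.hasSum.mul_right (-b 1)⁻¹)
  rw [mul_inv_cancel₀ (by linarith [hbw.neg])] at h
  have h0 : ∀ j, 0 ≤ (if j = 1 then 0 else b j) * (-b 1)⁻¹ := fun j => by
    split_ifs with hj
    · simp
    · exact mul_nonneg (hbw.nonneg j hj) (inv_nonneg.2 (by linarith [hbw.neg]))
  have h2 := ENNReal.ofReal_tsum_of_nonneg h0 h.summable
  rw [h.tsum_eq, ENNReal.ofReal_one] at h2
  rw [h2]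
  refine tsum_congr fun j => ?_
  unfold jumpLaw; split_ifs <;> simp [div_eq_mul_inv]

lemma tsum_crossWeight_le_one (hbw : IsBranchingData b w) : ∑' l, crossWeight b S l ≤ 1 :=
  tsum_hitTotal_le _ _ (by simp [jumpLaw_tsum hbw])

lemma hitTotal_ne_top (hbw : IsBranchingData b w) (i : ℕ) (l : S → ℕ) :
    hitTotal (jumpLaw b) (mark S) i l ≠ ∞ := by
  refine ne_top_of_le_ne_top ?_ (ENNReal.le_tsum l)
  rw [tsum_hitTotal]
  exact ENNReal.pow_ne_top (ne_top_of_le_ne_top ENNReal.one_ne_top (tsum_crossWeight_le_one hbw))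

lemma tsum_crossWeight_isMinRoot (hbw : IsBranchingData b w) :
    IsMinRoot b (∑' l, crossWeight b S l).toReal :=
  isMinRoot_of_fixed hbw.nonneg hbw.neg
    (ne_top_of_le_ne_top ENNReal.one_ne_top (tsum_crossWeight_le_one hbw))
    (tsum_hitTotal_fixed _ _).symm fun _ hy => tsum_hitTotal_le _ _ hy

lemma tsum_crossWeight_ne_zero (hbw : IsBranchingData b w) (hb0 : 0 < b 0) :
    ∑' l, crossWeight b S l ≠ 0 := by
  intro h
  have h1 := tsum_hitTotal_fixed (jumpLaw b) (mark S)
  change ∑' l, crossWeight b S l = ∑' j, jumpLaw b j * (∑' l, crossWeight b S l) ^ j at h1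
  rw [h] at h1
  have h2 := (ENNReal.tsum_eq_zero.1 h1.symm) 0
  have : 0 < b 0 / -b 1 := div_pos hb0 (by linarith [hbw.neg])
  simp [jumpLaw] at h2
  linarith

lemma offCoeff_nonneg (hbw : IsBranchingData b w) (j : ℕ) (hj : j ≠ 1) : 0 ≤ offCoeff b S j := by
  unfold offCoeff; split_ifs
  · exact le_rfl
  · exact hbw.nonneg j hj

lemma offCoeff_one (hS1 : 1 ∉ S) : offCoeff b S 1 = b 1 := by simp [offCoeff, hS1]

lemma jumpLaw_offCoeff (hS1 : 1 ∉ S) (j : ℕ) :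
    jumpLaw (offCoeff b S) j = if mark S j = 0 then jumpLaw b j else 0 := by
  unfold jumpLaw
  rw [offCoeff_one hS1]
  simp only [mark_eq_zero, offCoeff]
  split_ifs <;> simp_all

lemma crossWeight_zero_isMinRoot (hbw : IsBranchingData b w) (hS1 : 1 ∉ S) :
    IsMinRoot (offCoeff b S) (crossWeight b S 0).toReal := by
  refine isMinRoot_of_fixed (offCoeff_nonneg hbw) (by rw [offCoeff_one hS1]; exact hbw.neg)
    (hitTotal_ne_top hbw _ _) ?_ ?_
  · simp_rw [jumpLaw_offCoeff hS1]; exact (hitTotal_zero_fixed _ _).symm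
  · simp_rw [jumpLaw_offCoeff hS1]; exact fun y hy => hitTotal_zero_le _ _ hy

end Crossing

/-! ### The recursion for the crossing coefficients -/

/-- The tangent of `x ^ j` at a point of `[0, 1]` lies below `1` at `1`. -/
lemma pow_add_deriv_mul_le_one {x : ℝ} (hx0 : 0 ≤ x) (hx1 : x ≤ 1) (j : ℕ) :
    x ^ j + j * x ^ (j - 1) * (1 - x) ≤ 1 := by
  induction j with
  | zero => simp
  | succ j ih =>
    have h : (j : ℝ) * x ^ (j - 1) * x = j * x ^ j := by
      cases j with
      | zero => simp
      | succ j => simp only [Nat.add_sub_cancel]; ring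
    have h2 : 0 ≤ (j : ℝ) * x ^ (j - 1) * (1 - x) :=
      mul_nonneg (by positivity) (by linarith)
    have h3 := mul_le_mul_of_nonneg_right hx1 h2
    simp only [Nat.add_sub_cancel, Nat.cast_add, Nat.cast_one]
    calc x ^ (j + 1) + (j + 1) * x ^ j * (1 - x)
        = x ^ j + x * (j * x ^ (j - 1) * (1 - x)) := by
          linear_combination -(1 - x) * h
      _ ≤ 1 := by linarith

lemma summable_deriv_coeff {c : ℕ → ℝ} (hc : Summable fun j => |c j|) {x : ℝ} (hx0 : 0 ≤ x)
    (hx1 : x < 1) : Summable fun j => |c j| * (j * x ^ (j - 1)) := by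
  refine Summable.of_nonneg_of_le (fun j => by positivity) (fun j => ?_) (hc.mul_right (1 - x)⁻¹)
  refine mul_le_mul_of_nonneg_left ?_ (abs_nonneg _)
  rw [← one_div, le_div_iff₀ (by linarith)]
  have := pow_add_deriv_mul_le_one hx0 hx1.le j
  have := pow_nonneg hx0 j
  linarith

lemma hasDerivAt_powerSeries {c : ℕ → ℝ} (hc : Summable fun j => |c j|) {x : ℝ} (hx0 : 0 ≤ x)
    (hx1 : x < 1) :
    HasDerivAt (fun u => ∑' j, c j * u ^ j) (∑' j, c j * (j * x ^ (j - 1))) x := by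
  obtain ⟨R, hxR, hR1⟩ := exists_between hx1
  have hR0 : 0 < R := hx0.trans_lt hxR
  refine hasDerivAt_tsum_of_isPreconnected (summable_deriv_coeff hc hR0.le hR1)
    (t := Set.Ioo (-R) R) isOpen_Ioo isPreconnected_Ioo
    (g' := fun j y => c j * (j * y ^ (j - 1)))
    (fun j y _ => (hasDerivAt_pow j y).const_mul _) (fun j y hy => ?_) (y₀ := 0)
    ⟨by linarith, hR0⟩ ?_ ⟨by linarith, hxR⟩
  · rw [Real.norm_eq_abs, abs_mul, abs_mul, abs_pow, Nat.abs_cast]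
    have : |y| ≤ R := abs_le.2 ⟨hy.1.le, hy.2.le⟩
    gcongr
  · refine summable_of_ne_finset_zero (s := {0}) fun j hj => ?_
    simp only [Finset.mem_singleton] at hj
    simp [hj]

section Crossing

variable {b w : ℕ → ℝ} {S : Finset ℕ}

/-- First-step decomposition of the paths from `1`, with the marked jumps separated. -/
lemma crossWeight_eq (hS1 : 1 ∉ S) (l : S → ℕ) :
    crossWeight b S l = ∑' j, jumpLaw (offCoeff b S) j * hitTotal (jumpLaw b) (mark S) j l +
      ∑ k : S, jumpLaw b k * shift (mark S k) (hitTotal (jumpLaw b) (mark S) k) l := by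
  have h2 : ∑ k : S, jumpLaw b k * shift (mark S k) (hitTotal (jumpLaw b) (mark S) k) l =
      ∑' j, if j ∈ S then jumpLaw b j * shift (mark S j) (hitTotal (jumpLaw b) (mark S) j) l
        else 0 := by
    rw [tsum_eq_sum (s := S) fun j hj => if_neg hj]
    rw [Finset.sum_coe_sort S
      fun j => jumpLaw b j * shift (mark S j) (hitTotal (jumpLaw b) (mark S) j) l]
    exact Finset.sum_congr rfl fun j hj => (if_pos hj).symm
  rw [h2, ← ENNReal.tsum_add]
  refine (hitTotal_succ _ _ 0 l).trans (tsum_congr fun j => ?_)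
  rw [jumpLaw_offCoeff hS1, zero_add]
  by_cases h : j ∈ S
  · rw [if_pos h, if_neg (by simpa [mark_eq_zero] using h)]; simp
  · have h0 : mark S j = 0 := mark_eq_zero.2 h
    rw [if_neg h, if_pos h0, h0, shift_zero, add_zero]

lemma jumpLaw_toReal {d : ℕ → ℝ} (hd : ∀ j, j ≠ 1 → 0 ≤ d j) (hd1 : d 1 < 0) (j : ℕ) :
    (jumpLaw d j).toReal = if j = 1 then 0 else d j / -d 1 := by
  unfold jumpLaw
  split_ifs with h
  · simp
  · exact ENNReal.toReal_ofReal (div_nonneg (hd j h) (by linarith))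

lemma tsum_jumpLaw_offCoeff_lt_one (hbw : IsBranchingData b w) (hS1 : 1 ∉ S)
    (hSb : ∀ k ∈ S, 0 < b k) (hS : S.Nonempty) : ∑' j, jumpLaw (offCoeff b S) j < 1 := by
  rw [← jumpLaw_tsum hbw]
  obtain ⟨k, hk⟩ := hS
  have hk1 : k ≠ 1 := fun h => hS1 (h ▸ hk)
  have hle : ∀ j, jumpLaw (offCoeff b S) j ≤ jumpLaw b j := fun j => by
    rw [jumpLaw_offCoeff hS1]; split_ifs <;> simp
  refine ENNReal.tsum_lt_tsum (i := k) ?_ hle ?_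
  · exact ne_top_of_le_ne_top ENNReal.one_ne_top
      ((ENNReal.tsum_le_tsum hle).trans (jumpLaw_tsum hbw).le)
  · rw [jumpLaw_offCoeff hS1, if_neg (by simpa [mark_eq_zero] using hk)]
    simp only [jumpLaw, hk1, if_false, ENNReal.ofReal_pos]
    exact div_pos (hSb k hk) (by linarith [hbw.neg])

lemma isCrossingCoeff_crossWeight (hbw : IsBranchingData b w) (hS1 : 1 ∉ S)
    (hSb : ∀ k ∈ S, 0 < b k) : IsCrossingCoeff b fun l : S → ℕ => (crossWeight b S l).toReal := by
  set r : (S → ℕ) → ℝ := fun l => (crossWeight b S l).toReal with hr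
  set β : ℝ := -b 1 with hβ
  have hβ0 : 0 < β := by linarith [hbw.neg]
  have hoff1 : offCoeff b S 1 < 0 := by rw [offCoeff_one hS1]; exact hbw.neg
  set a : ℕ → ℝ := fun j => if j = 1 then 0 else offCoeff b S j / β with ha
  have ha' : ∀ j, (jumpLaw (offCoeff b S) j).toReal = a j := fun j => by
    rw [jumpLaw_toReal (offCoeff_nonneg hbw) hoff1, offCoeff_one hS1]
  have ha0 : ∀ j, 0 ≤ a j := fun j => by rw [← ha']; exact ENNReal.toReal_nonneg
  have hr0 : ∀ l, 0 ≤ r l := fun l => ENNReal.toReal_nonneg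
  have hroot := crossWeight_zero_isMinRoot (S := S) hbw hS1
  -- The facts for `l ≠ 0`, which forces `S` to be nonempty and hence `r 0 < 1`.
  have key : ∀ l : S → ℕ, l ≠ 0 →
      HasSum (fun j => a j * convLower r j l)
          (r l * (1 - ∑' j, a j * (j * r 0 ^ (j - 1))) -
            ∑ k : S, if 1 ≤ l k then b k / β * conv r k (l - Pi.single k 1) else 0) ∧
        deriv (Bbar b S) (r 0) = -β * (1 - ∑' j, a j * (j * r 0 ^ (j - 1))) ∧
        0 < 1 - ∑' j, a j * (j * r 0 ^ (j - 1)) := by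
    intro l hl
    have hS : S.Nonempty := by
      by_contra h
      rw [Finset.not_nonempty_iff_eq_empty] at h
      apply hl; funext k; exact absurd k.2 (by simp [h])
    have hlt := tsum_jumpLaw_offCoeff_lt_one hbw hS1 hSb hS
    have hasum := ENNReal.hasSum_toReal hlt.ne_top
    have halt : ∑' j, a j < 1 := by
      have := (ENNReal.toReal_lt_toReal hlt.ne_top ENNReal.one_ne_top).2 hlt
      rw [ENNReal.tsum_toReal_eq (fun j => ne_top_of_le_ne_top hlt.ne_top (ENNReal.le_tsum j))]
        at this
      simpa only [ha', ENNReal.toReal_one] using this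
    simp only [ha'] at hasum
    have hroot0 : HasSum (fun j => a j * r 0 ^ j) (r 0) := by
      have h1 := hroot.1.2
      have h2 := (h1.mul_left β⁻¹).add (hasSum_ite_eq 1 (r 0))
      simp only [mul_zero, zero_add] at h2
      refine h2.congr_fun fun j => ?_
      simp only [ha]
      by_cases h : j = 1
      · subst h
        simp only [if_true, offCoeff_one hS1, zero_mul, pow_one]
        field_simp
        simp only [hβ]; ring
      · simp only [h, if_false, add_zero]; field_simp; rfl
    have hr0le : r 0 ≤ 1 := by
      have h : crossWeight b S 0 ≤ 1 :=
        (ENNReal.le_tsum (f := crossWeight b S) 0).trans (tsum_crossWeight_le_one hbw)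
      exact ENNReal.toReal_le_of_le_ofReal zero_le_one (by rwa [ENNReal.ofReal_one])
    have hr0lt : r 0 < 1 := by
      refine lt_of_le_of_lt ?_ halt
      rw [← hroot0.tsum_eq]
      exact hroot0.summable.tsum_le_tsum
        (fun j => mul_le_of_le_one_right (ha0 j) (pow_le_one₀ (hr0 0) hr0le)) hasum.summable
    have hDsum : Summable fun j => a j * (j * r 0 ^ (j - 1)) := by
      have := summable_deriv_coeff (c := a) (by simpa only [abs_of_nonneg (ha0 _)] using
        hasum.summable) (hr0 0) hr0lt
      simpa only [abs_of_nonneg (ha0 _)] using this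
    set D : ℝ := ∑' j, a j * (j * r 0 ^ (j - 1)) with hD
    refine ⟨?_, ?_, ?_⟩
    · have hfin : ∀ i l, hitTotal (jumpLaw b) (mark S) i l ≠ ∞ := hitTotal_ne_top hbw
      have heq := crossWeight_eq (b := b) hS1 l
      have hne := hfin 1 l
      change crossWeight b S l ≠ ∞ at hne
      have hne' := hne
      rw [heq, ENNReal.add_ne_top] at hne'
      have h1 := ENNReal.hasSum_toReal hne'.1
      have h2 : r l = ∑' j, (jumpLaw (offCoeff b S) j * hitTotal (jumpLaw b) (mark S) j l).toReal +
          ∑ k : S, if 1 ≤ l k then b k / β * conv r k (l - Pi.single k 1) else 0 := by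
        simp only [hr]
        rw [heq, ENNReal.toReal_add hne'.1 hne'.2, ENNReal.tsum_toReal_eq
          (fun j => ne_top_of_le_ne_top hne'.1 (ENNReal.le_tsum j)),
          ENNReal.toReal_sum (fun k hk => (ENNReal.sum_ne_top.1 hne'.2) k hk)]
        congr 1
        refine Finset.sum_congr rfl fun k _ => ?_
        have hk1 : (k : ℕ) ≠ 1 := fun h => hS1 (h ▸ k.2)
        rw [ENNReal.toReal_mul, jumpLaw_toReal hbw.nonneg hbw.neg, if_neg hk1]
        unfold shift
        simp only [mark_coe_le]
        split_ifs with h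
        · rw [mark_coe]
          congr 1
          exact (conv_toReal _ _ _ _ hfin).symm
        · simp
      have hcv : ∀ j, (jumpLaw (offCoeff b S) j * hitTotal (jumpLaw b) (mark S) j l).toReal =
          a j * convLower r j l + a j * (j * r 0 ^ (j - 1)) * r l := fun j => by
        rw [ENNReal.toReal_mul, ha', ← conv_toReal _ _ _ _ hfin,
          conv_eq_convLower_add _ _ hl]
        simp only [hr, crossWeight]; ring
      simp only [hcv] at h1 h2
      have h3 := h1.sub (hDsum.hasSum.mul_right (r l))
      simp only [add_sub_cancel_right] at h3
      rw [← hD] at h3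
      refine Eq.subst (motive := fun x => HasSum (fun j => a j * convLower r j l) x) ?_ h3
      linear_combination -h2
    · have hcs : Summable fun j => |offCoeff b S j| := by
        refine ((hasum.summable.mul_left β).add (hasSum_ite_eq 1 β).summable).congr fun j => ?_
        simp only [ha]
        by_cases h : j = 1
        · subst h
          simp only [if_true, offCoeff_one hS1, mul_zero, zero_add]
          rw [abs_of_neg hbw.neg]
        · simp only [h, if_false, add_zero]
          rw [abs_of_nonneg (offCoeff_nonneg hbw j h)]
          field_simp
      have hder := (hasDerivAt_powerSeries hcs (hr0 0) hr0lt).deriv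
      change deriv (Bbar b S) (r 0) = _ at hder
      rw [hder]
      have h1 := ((hDsum.hasSum.sub (hasSum_ite_eq 1 (1 : ℝ))).mul_left β)
      rw [show -β * (1 - D) = β * (D - 1) by ring, ← h1.tsum_eq]
      refine tsum_congr fun j => ?_
      simp only [ha]
      by_cases h : j = 1
      · subst h; simp [offCoeff_one hS1, hβ]
      · simp only [h, if_false, sub_zero]; field_simp
    -- Convexity: the tangent at `r 0` lies below the generating function at `1`, which is `< 1`.
    · have h1 : ∑' j, (a j * r 0 ^ j + a j * (j * r 0 ^ (j - 1)) * (1 - r 0)) ≤ ∑' j, a j := by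
        refine (hroot0.summable.add (hDsum.mul_right _)).tsum_le_tsum (fun j => ?_) hasum.summable
        have := mul_le_mul_of_nonneg_left (pow_add_deriv_mul_le_one (hr0 0) hr0le j) (ha0 j)
        linarith
      rw [(hroot0.add (hDsum.hasSum.mul_right (1 - r 0))).tsum_eq] at h1
      have : (1 - r 0) * (D - 1) < 0 := by linarith
      have := neg_of_mul_neg_right this (by linarith)
      linarith
  have hterm : ∀ (l : S → ℕ) j, (if j = 1 then 0 else offCoeff b S j * convLower r j l) =
      β * (a j * convLower r j l) := fun l j => by
    simp only [ha]; split_ifs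
    · simp
    · field_simp
  refine ⟨hroot, fun l hl => ?_, fun l hl => ?_⟩
  · simp_rw [hterm]
    exact (key l hl).1.summable.mul_left β
  · obtain ⟨h1, h2, h3⟩ := key l hl
    simp_rw [hterm]
    rw [(h1.mul_left β).tsum_eq, h2]
    have h4 : ∑ k : S, (if 1 ≤ l k then b k * conv r k (l - Pi.single k 1) else 0) =
        β * ∑ k : S, if 1 ≤ l k then b k / β * conv r k (l - Pi.single k 1) else 0 := by
      rw [Finset.mul_sum]
      refine Finset.sum_congr rfl fun k _ => ?_
      split_ifs
      · field_simp
      · simp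
    rw [h4]
    set D : ℝ := ∑' j, a j * (j * r 0 ^ (j - 1)) with hD
    field_simp
    ring

lemma convLower_congr {r r' : (S → ℕ) → ℝ} {l : S → ℕ}
    (h : ∀ m : S → ℕ, ∑ k, m k < ∑ k, l k → r m = r' m) (j : ℕ) :
    convLower r j l = convLower r' j l := by
  unfold convLower
  refine Finset.sum_congr rfl fun f hf => Finset.prod_congr rfl fun i _ => ?_
  exact h _ ((Finset.mem_filter.1 hf).2 i)

lemma conv_congr {r r' : (S → ℕ) → ℝ} {l : S → ℕ}
    (h : ∀ m ≤ l, r m = r' m) (j : ℕ) : conv r j l = conv r' j l := by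
  unfold conv
  refine Finset.sum_congr rfl fun f hf => Finset.prod_congr rfl fun i _ => h _ ?_
  rw [mem_tuples] at hf
  rw [← hf]
  exact Finset.single_le_sum (f := f) (fun _ _ => zero_le) (Finset.mem_univ i)

/-- The recursion determines the coefficients by induction on the total degree. -/
lemma IsCrossingCoeff.unique {r r' : (S → ℕ) → ℝ} (h : IsCrossingCoeff b r)
    (h' : IsCrossingCoeff b r') : r = r' := by
  have h0 : r 0 = r' 0 := h.zero.unique h'.zero
  have key : ∀ n, ∀ l : S → ℕ, ∑ k, l k = n → r l = r' l := by
    intro n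
    induction n using Nat.strong_induction_on with
    | _ n ih =>
      intro l hl
      by_cases hl0 : l = 0
      · rw [hl0, h0]
      have hlow : ∀ m : S → ℕ, ∑ k, m k < ∑ k, l k → r m = r' m :=
        fun m hm => ih _ (hl ▸ hm) m rfl
      rw [h.recursion l hl0, h'.recursion l hl0, h0]
      simp_rw [convLower_congr hlow]
      congr 3
      refine Finset.sum_congr rfl fun k _ => ?_
      split_ifs with hk
      · congr 1
        refine conv_congr (fun m hm => hlow m (Finset.sum_lt_sum (fun i _ => ?_) ⟨k, ?_, ?_⟩)) _
        · exact (hm i).trans (Nat.sub_le _ _)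
        · simp
        · have := hm k
          simp only [Pi.sub_apply, Pi.single_eq_same] at this
          omega
      · rfl
  funext l
  exact key _ l rfl

end Crossing

/-! ### Jump histories of right-continuous paths -/

/-- `JumpHist x t γ`: the path `x` jumps at time `t` (or `t = 0`), and `γ` is the finite list of the
states visited up to time `t`, the latest first. -/
inductive JumpHist (x : ℝ≥0 → ℕ) : ℝ≥0 → List ℕ → Prop
  | start : JumpHist x 0 [x 0]
  | jump {s t : ℝ≥0} {y : ℕ} {γ : List ℕ} (h : JumpHist x s (y :: γ)) (hst : s < t)
      (hy : ∀ u, s ≤ u → u < t → x u = y) (hne : x t ≠ y) : JumpHist x t (x t :: y :: γ)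

/-- The number of jumps of size `k - 1`, for each `k ∈ S`, in a history with the latest state
first. -/
def crossCount (S : Finset ℕ) : List ℕ → S → ℕ
  | y :: y' :: γ => fun k => (if y + 1 = y' + k then 1 else 0) + crossCount S (y' :: γ) k
  | _ => 0

/-- Histories stopped at the first visit of `0` and after `n` jumps at the latest. -/
def IsStopped (n : ℕ) (γ : List ℕ) : Prop :=
  0 ∉ γ.tail ∧ γ.length ≤ n + 1 ∧ (γ.length = n + 1 ∨ γ.head? = some 0)

/-- Right-continuity in the discrete space `ℕ`. -/
def IsRightCont (x : ℝ≥0 → ℕ) : Prop := ∀ t : ℝ≥0, ∀ᶠ s in 𝓝[>] t, x s = x t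

section Path

variable {x : ℝ≥0 → ℕ} {t : ℝ≥0} {γ : List ℕ}

lemma IsCadlagPath.isRightCont (hx : IsCadlagPath x) : IsRightCont x := fun t => (hx t).1

lemma JumpHist.eq_cons (h : JumpHist x t γ) : ∃ γ', γ = x t :: γ' := by
  cases h with
  | start => exact ⟨_, rfl⟩
  | jump => exact ⟨_, rfl⟩

lemma JumpHist.mem_tail_of_lt (h : JumpHist x t γ) : ∀ u < t, x u ∈ γ.tail := by
  induction h with
  | start => intro u hu; exact absurd hu not_lt_zero
  | @jump s t y γ h hst hy hne ih =>
    intro u hu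
    simp only [List.tail_cons]
    by_cases hsu : s ≤ u
    · rw [hy u hsu hu]; exact List.mem_cons_self
    · exact List.mem_cons_of_mem _ (ih u (not_le.1 hsu))

lemma JumpHist.exists_of_mem_tail (h : JumpHist x t γ) : ∀ y ∈ γ.tail, ∃ u < t, x u = y := by
  induction h with
  | start => intro y hy; simp at hy
  | @jump s t y γ h hst hy hne ih =>
    intro y' hy'
    simp only [List.tail_cons, List.mem_cons] at hy'
    rcases hy' with rfl | hy'
    · exact ⟨s, hst, hy s le_rfl hst⟩
    · obtain ⟨u, hu, h2⟩ := ih y' hy'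
      exact ⟨u, hu.trans hst, h2⟩

lemma IsRightCont.exists_Ioo (hx : IsRightCont x) (t : ℝ≥0) :
    ∃ c > t, ∀ s, t ≤ s → s < c → x s = x t := by
  obtain ⟨c, hc, h⟩ := mem_nhdsGT_iff_exists_Ioo_subset.1 (hx t)
  refine ⟨c, hc, fun s hs hsc => ?_⟩
  rcases hs.eq_or_lt with rfl | hs
  · rfl
  · exact h ⟨hs, hsc⟩

/-- By right-continuity the infimum of a set of times defined by the current state has the limit
state. -/
lemma IsRightCont.sInf_mem (hx : IsRightCont x) {p : ℕ → Prop} {A : Set ℝ≥0}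
    (hA : ∀ u ∈ A, p (x u)) (hne : A.Nonempty) : p (x (sInf A)) := by
  obtain ⟨c, hc, h⟩ := hx.exists_Ioo (sInf A)
  obtain ⟨a, ha, hac⟩ := exists_lt_of_csInf_lt hne hc
  rw [← h a (csInf_le (OrderBot.bddBelow _) ha) hac]
  exact hA a ha

/-- If the path leaves its current state, the infimum of the times at which it is elsewhere is the
next jump time. -/
lemma JumpHist.exists_next (h : JumpHist x t γ) (hx : IsRightCont x) {u : ℝ≥0} (htu : t < u)
    (hu : x u ≠ x t) : ∃ t', t < t' ∧ t' ≤ u ∧ x t' ≠ x t ∧ JumpHist x t' (x t' :: γ) := by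
  obtain ⟨γ', rfl⟩ := h.eq_cons
  set A : Set ℝ≥0 := {u | t < u ∧ x u ≠ x t} with hA
  have hne : A.Nonempty := ⟨u, htu, hu⟩
  have h1 : x (sInf A) ≠ x t := hx.sInf_mem (p := fun y => y ≠ x t) (fun u hu => hu.2) hne
  have h2 : t < sInf A := by
    refine lt_of_le_of_ne (le_csInf hne fun v hv => hv.1.le) fun he => h1 (by rw [← he])
  refine ⟨sInf A, h2, csInf_le (OrderBot.bddBelow _) ⟨htu, hu⟩, h1, h.jump h2 ?_ h1⟩
  intro v htv hv
  by_contra hvt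
  rcases htv.eq_or_lt with rfl | htv
  · exact hvt rfl
  · exact absurd (csInf_le (OrderBot.bddBelow _) (show v ∈ A from ⟨htv, hvt⟩)) (not_le.2 hv)

lemma JumpHist.exists_stopped (hx : IsRightCont x)
    (hstuck : ∀ t, x t ≠ 0 → ∃ u > t, x u ≠ x t) (n : ℕ) :
    ∃ t γ, JumpHist x t γ ∧ IsStopped n γ := by
  induction n with
  | zero => exact ⟨0, _, .start, by simp [IsStopped]⟩
  | succ n ih =>
    obtain ⟨t, γ, h, h0, hlen, hor⟩ := ih
    obtain ⟨γ', rfl⟩ := h.eq_cons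
    by_cases hz : x t = 0
    · exact ⟨t, _, h, h0, by omega, Or.inr (by simp [hz])⟩
    · obtain ⟨u, htu, hu⟩ := hstuck t hz
      obtain ⟨t', _, _, _, h'⟩ := h.exists_next hx htu hu
      have hl : (x t :: γ').length = n + 1 := by
        rcases hor with h | h
        · exact h
        · exact absurd (by simpa using h) hz
      refine ⟨t', _, h', ?_, ?_, Or.inl ?_⟩
      · simp only [List.tail_cons, List.mem_cons, not_or]
        exact ⟨fun h => hz h.symm, h0⟩
      · simp only [List.length_cons] at *; omega
      · simp only [List.length_cons] at *; omega

/-- A càdlàg path that hits `0` does so after finitely many jumps: otherwise the jump times would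
accumulate at a time without left limit. -/
lemma IsCadlagPath.exists_jumpHist (hx : IsCadlagPath x) (hfin : extinctionTime x < ∞) :
    ∃ t γ, JumpHist x t γ ∧ extinctionTime x = t ∧ x t = 0 := by
  have hr := hx.isRightCont
  set A : Set ℝ≥0 := {t | x t = 0} with hA
  have hne : A.Nonempty := by
    by_contra h
    rw [Set.not_nonempty_iff_eq_empty] at h
    have : extinctionTime x = ∞ := by
      unfold extinctionTime
      refine iInf₂_eq_top.2 fun t ht => ?_
      exact absurd (show t ∈ A from ht) (by simp [h])
    exact hfin.ne this
  have h0 : x (sInf A) = 0 := hr.sInf_mem (p := fun y => y = 0) (fun u hu => hu) hne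
  have hext : extinctionTime x = (sInf A : ℝ≥0) :=
    le_antisymm (iInf₂_le (f := fun (t : ℝ≥0) (_ : x t = 0) => (t : ℝ≥0∞)) (sInf A) h0)
      (le_iInf₂ fun t ht =>
      ENNReal.coe_le_coe.2 (csInf_le (OrderBot.bddBelow _) ht))
  have hpos : ∀ t < sInf A, x t ≠ 0 := fun t ht h =>
    absurd (csInf_le (OrderBot.bddBelow _) (show t ∈ A from h)) (not_le.2 ht)
  set t₀ := sInf A with ht₀
  set B : Set ℝ≥0 := {t | t ≤ t₀ ∧ ∃ γ, JumpHist x t γ} with hB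
  have hBb : BddAbove B := ⟨t₀, fun t ht => ht.1⟩
  have hB0 : (0 : ℝ≥0) ∈ B := ⟨zero_le, _, .start⟩
  have hle : sSup B ≤ t₀ := csSup_le ⟨0, hB0⟩ fun t ht => ht.1
  have hnext : ∀ t ∈ B, t < t₀ → ∃ t' ∈ B, t < t' ∧ x t' ≠ x t := by
    rintro t ⟨_, γ, h⟩ htt
    obtain ⟨t', h1, h2, h3, h4⟩ := h.exists_next hr htt (by rw [h0]; exact (hpos t htt).symm)
    exact ⟨t', ⟨h2, _, h4⟩, h1, h3⟩
  have hmem : sSup B ∈ B := by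
    by_contra hnot
    have hs0 : 0 < sSup B := lt_of_le_of_ne (le_csSup hBb hB0) fun h => hnot (h ▸ hB0)
    obtain ⟨i, hi⟩ := (hx (sSup B)).2
    obtain ⟨c, hc, hci⟩ := (mem_nhdsLT_iff_exists_Ioo_subset' hs0).1 hi
    obtain ⟨t, ht, hct⟩ := exists_lt_of_lt_csSup ⟨0, hB0⟩ hc
    have htlt : ∀ t ∈ B, t < sSup B := fun t ht =>
      lt_of_le_of_ne (le_csSup hBb ht) fun h => hnot (h ▸ ht)
    obtain ⟨t', ht', htt', hxt⟩ := hnext t ht ((htlt t ht).trans_le hle)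
    exact hxt ((hci ⟨hct.trans htt', htlt t' ht'⟩ : x t' = i).trans
      (hci ⟨hct, htlt t ht⟩ : x t = i).symm)
  have heq : sSup B = t₀ := by
    by_contra hne'
    obtain ⟨t', ht', htt', _⟩ := hnext _ hmem (lt_of_le_of_ne hle hne')
    exact absurd (le_csSup hBb ht') (not_le.2 htt')
  rw [heq] at hmem
  obtain ⟨_, γ, h⟩ := hmem
  exact ⟨t₀, γ, h, hext, h0⟩

/-- The crossing numbers can be read off the history. The assumption `1 ∉ S` matters, since
`HasJump x 1 s` holds at the times `s` without jump. -/
lemma JumpHist.crossing {S : Finset ℕ} (hS1 : 1 ∉ S) (h : JumpHist x t γ) (k : S) :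
    {s | s ≤ t ∧ HasJump x k s}.Finite ∧
      {s | s ≤ t ∧ HasJump x k s}.ncard = crossCount S γ k := by
  have hk1 : (k : ℕ) ≠ 1 := fun h => hS1 (h ▸ k.2)
  induction h with
  | start =>
    have : {s | s ≤ 0 ∧ HasJump x k s} = ∅ := by
      ext s
      simp only [Set.mem_ofPred_eq, Set.mem_empty_iff_false, iff_false, not_and]
      exact fun hs h => absurd h.1 (not_lt.2 hs)
    rw [this]; simp [crossCount]
  | @jump s t y γ h hst hy hne ih =>
    have hleft : ∀ u, s < u → u ≤ t → (HasJump x k u ↔ x u + 1 = y + k) := by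
      intro u hsu hut
      have hev : ∀ᶠ r in 𝓝[<] u, x r = y := by
        filter_upwards [Ioo_mem_nhdsLT hsu] with r hr
        exact hy r hr.1.le (hr.2.trans_le hut)
      constructor
      · rintro ⟨_, i, hi, h2⟩
        have : (𝓝[<] u).NeBot := nhdsLT_neBot_of_exists_lt ⟨s, hsu⟩
        obtain ⟨r, hr1, hr2⟩ := (hi.and hev).exists
        rw [← hr2, hr1]; exact h2
      · exact fun h2 => ⟨(zero_le).trans_lt hsu, y, hev, h2⟩
    have hset : {u | u ≤ t ∧ HasJump x k u} =
        {u | u ≤ s ∧ HasJump x k u} ∪ (if x t + 1 = y + k then {t} else ∅) := by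
      ext u
      simp only [Set.mem_ofPred_eq, Set.mem_union]
      constructor
      · rintro ⟨hut, hj⟩
        by_cases hus : u ≤ s
        · exact Or.inl ⟨hus, hj⟩
        right
        rw [hleft u (not_le.1 hus) hut] at hj
        rcases hut.eq_or_lt with rfl | hut
        · rw [if_pos hj]; rfl
        · rw [hy u (not_le.1 hus).le hut] at hj; omega
      · rintro (⟨h1, h2⟩ | h1)
        · exact ⟨h1.trans hst.le, h2⟩
        · split_ifs at h1 with h2
          · rw [Set.mem_singleton_iff] at h1
            subst h1
            exact ⟨le_rfl, (hleft u hst le_rfl).2 h2⟩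
          · exact absurd h1 (Set.notMem_empty _)
    have hdisj : Disjoint {u | u ≤ s ∧ HasJump x k u}
        (if x t + 1 = y + k then {t} else ∅) := by
      split_ifs
      · rw [Set.disjoint_singleton_right]; exact fun h => absurd h.1 (not_le.2 hst)
      · exact Set.disjoint_empty _
    have hfin2 : (if x t + 1 = y + k then ({t} : Set ℝ≥0) else ∅).Finite := by
      split_ifs <;> simp
    rw [hset]
    refine ⟨ih.1.union hfin2, ?_⟩
    rw [Set.ncard_union_eq hdisj ih.1 hfin2, ih.2]
    simp only [crossCount]
    split_ifs <;> simp [add_comm]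

end Path

/-! ### Histories of discrete skeletons -/

/-- The states visited by the sequence `z` up to time `m`, the latest first, without
repetitions. -/
def skelHist (z : ℕ → ℕ) : ℕ → List ℕ
  | 0 => [z 0]
  | m + 1 => if z (m + 1) = z m then skelHist z m else z (m + 1) :: skelHist z m

section Skeleton

variable {z : ℕ → ℕ}

lemma skelHist_eq_cons (z : ℕ → ℕ) (m : ℕ) : ∃ γ, skelHist z m = z m :: γ := by
  induction m with
  | zero => exact ⟨_, rfl⟩
  | succ m ih =>
    unfold skelHist
    split_ifs with h
    · rw [h]; exact ih
    · exact ⟨_, rfl⟩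

lemma skelHist_congr {z z' : ℕ → ℕ} {m : ℕ} (h : ∀ i ≤ m, z i = z' i) :
    skelHist z m = skelHist z' m := by
  induction m with
  | zero => simp [skelHist, h 0 le_rfl]
  | succ m ih =>
    simp only [skelHist, h (m + 1) le_rfl, h m (Nat.le_succ m),
      ih fun i hi => h i (hi.trans (Nat.le_succ m))]

lemma skelHist_eq_of_const {m m' : ℕ} (hm : m ≤ m') (h : ∀ i, m ≤ i → i ≤ m' → z i = z m) :
    skelHist z m' = skelHist z m := by
  induction m', hm using Nat.le_induction with
  | base => rfl
  | succ m' hm ih =>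
    rw [skelHist, if_pos, ih fun i h1 h2 => h i h1 (h2.trans (Nat.le_succ _))]
    rw [h _ (hm.trans (Nat.le_succ _)) le_rfl, h m' hm (Nat.le_succ _)]

lemma skelHist_suffix {m m' : ℕ} (hm : m ≤ m') : skelHist z m <:+ skelHist z m' := by
  induction m', hm using Nat.le_induction with
  | base => exact List.suffix_rfl
  | succ m' hm ih =>
    rw [skelHist]
    split_ifs
    · exact ih
    · exact ih.trans (List.suffix_cons _ _)

/-- Along one skeleton at most one stopped history of a given level occurs. -/
lemma IsStopped.eq_of_skelHist {n : ℕ} {γ γ' : List ℕ} (h : IsStopped n γ) (h' : IsStopped n γ')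
    {m m' : ℕ} (hm : skelHist z m = γ) (hm' : skelHist z m' = γ') : γ = γ' := by
  have key : ∀ {γ γ' : List ℕ}, IsStopped n γ → IsStopped n γ' → γ <:+ γ' → γ = γ' := by
    intro γ γ' h h' hs
    rcases hs.length_le.eq_or_lt with he | hlt
    · exact hs.eq_of_length he
    · exfalso
      obtain ⟨p, rfl⟩ := hs
      have hl := h'.2.1
      rcases h.2.2 with h1 | h1
      · omega
      · cases p with
        | nil => simp at hlt
        | cons a p =>
          apply h'.1
          simp only [List.cons_append, List.tail_cons, List.mem_append]
          exact Or.inr (List.mem_of_mem_head? (by simp [h1]))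
  rcases le_total m m' with hle | hle
  · exact key h h' (hm ▸ hm' ▸ skelHist_suffix hle)
  · exact (key h' h (hm ▸ hm' ▸ skelHist_suffix hle)).symm

/-- A sufficiently fine skeleton reproduces the jump history of the path. -/
lemma JumpHist.exists_skelHist {x : ℝ≥0 → ℕ} {t : ℝ≥0} {γ : List ℕ} (h : JumpHist x t γ) :
    ∃ δ > (0 : ℝ≥0), ∀ h : ℝ≥0, 0 < h → h < δ → ∀ m : ℕ, t ≤ m * h →
      (∀ u, t ≤ u → u ≤ m * h → x u = x t) → skelHist (fun m : ℕ => x (m * h)) m = γ := by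
  induction h with
  | start =>
    refine ⟨1, one_pos, fun h _ _ m _ hc => ?_⟩
    rw [skelHist_eq_of_const (Nat.zero_le m)]
    · simp [skelHist]
    · intro i _ him
      have : (i : ℝ≥0) * h ≤ m * h := by gcongr
      simpa using hc _ zero_le this
  | @jump s t y γ hj hst hy hne ih =>
    obtain ⟨δ, hδ, ih⟩ := ih
    refine ⟨min δ (t - s), lt_min hδ (tsub_pos_of_lt hst), fun h hpos hlt m htm hc => ?_⟩
    -- `k + 1` is the first grid point after the jump time `t`; the mesh is so small that `k` lies in
    -- the preceding holding interval `[s, t)`.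
    have hex : ∃ m' : ℕ, t ≤ m' * h := ⟨m, htm⟩
    classical
    obtain ⟨k, hk⟩ : ∃ k, Nat.find hex = k + 1 := by
      refine Nat.exists_eq_succ_of_ne_zero fun h0 => ?_
      have := Nat.find_spec hex
      rw [h0] at this
      simp only [Nat.cast_zero, zero_mul, nonpos_iff_eq_zero] at this
      exact absurd hst (by simp [this])
    have hkt : (k : ℝ≥0) * h < t := not_le.1 (Nat.find_min hex (by omega : k < Nat.find hex))
    have hk1t : t ≤ ((k + 1 : ℕ) : ℝ≥0) * h := hk ▸ Nat.find_spec hex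
    have hkm : k + 1 ≤ m := hk ▸ Nat.find_min' hex htm
    have hsk : s ≤ k * h := by
      have h1 : h < t - s := hlt.trans_le (min_le_right _ _)
      have h2 : s + h < t := by rw [add_comm]; exact lt_tsub_iff_right.1 h1
      push_cast at hk1t
      rw [add_mul, one_mul] at hk1t
      exact (lt_of_add_lt_add_right (h2.trans_le hk1t)).le
    have hys : x s = y := hy s le_rfl hst
    have hik := ih h hpos (hlt.trans_le (min_le_left _ _)) k hsk fun u h1 h2 => by
      rw [hys]; exact hy u h1 (h2.trans_lt hkt)
    have hxk : x (k * h) = y := hy _ hsk hkt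
    have hgrid : ∀ i : ℕ, k + 1 ≤ i → i ≤ m → x (i * h) = x t := fun i h1 h2 =>
      hc _ (hk1t.trans (by gcongr)) (by gcongr)
    rw [skelHist_eq_of_const hkm, skelHist, hik, if_neg, hgrid (k + 1) le_rfl hkm]
    · rw [hgrid (k + 1) le_rfl hkm, hxk]; exact hne
    · intro i h1 h2
      rw [hgrid i h1 h2, hgrid (k + 1) le_rfl hkm]

lemma JumpHist.eventually_skelHist {x : ℝ≥0 → ℕ} (hx : IsRightCont x) {t : ℝ≥0} {γ : List ℕ}
    (h : JumpHist x t γ) {ε : ℕ → ℝ≥0} (hε : ∀ n, 0 < ε n)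
    (hε0 : Filter.Tendsto ε Filter.atTop (𝓝 0)) :
    ∀ᶠ n in Filter.atTop, ∃ m, skelHist (fun m : ℕ => x (m * ε n)) m = γ := by
  obtain ⟨δ, hδ, hsk⟩ := h.exists_skelHist
  obtain ⟨c, hc, hxc⟩ := hx.exists_Ioo t
  filter_upwards [hε0.eventually_lt_const hδ, hε0.eventually_lt_const (tsub_pos_of_lt hc)]
    with n h1 h2
  have hne := (hε n).ne'
  refine ⟨⌈t / ε n⌉₊, hsk _ (hε n) h1 _ ?_ fun u hu1 hu2 => hxc u hu1 (hu2.trans_lt ?_)⟩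
  · have := Nat.le_ceil (t / ε n)
    rwa [div_le_iff₀ (hε n)] at this
  · have := Nat.ceil_lt_add_one (zero_le : 0 ≤ t / ε n)
    calc (⌈t / ε n⌉₊ : ℝ≥0) * ε n < (t / ε n + 1) * ε n := by
          exact mul_lt_mul_of_pos_right this (hε n)
      _ = t + ε n := by rw [add_mul, one_mul, div_mul_cancel₀ _ hne]
      _ < c := by rw [add_comm]; exact lt_tsub_iff_right.1 h2

end Skeleton

/-! ### Transition probabilities of the embedded jump chain -/

/-- The probability that the embedded jump chain moves from `x` to `y`. -/
noncomputable def stepProb (b : ℕ → ℝ) (x y : ℕ) : ℝ :=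
  if 1 ≤ x ∧ x ≤ y + 1 ∧ y ≠ x then b (y + 1 - x) / -b 1 else 0

/-- The probability that a chain with transition matrix `p h` moves to `y` when it leaves `x`. -/
noncomputable def skelStep (p : ℝ → ℕ → ℕ → ℝ) (h : ℝ) (x y : ℕ) : ℝ :=
  if y = x then 0 else p h x y / (1 - p h x x)

/-- The product of the one-step weights `κ` along a history that starts at `1`. -/
noncomputable def histWeight (κ : ℕ → ℕ → ℝ) : List ℕ → ℝ
  | [] => 0
  | [y] => if y = 1 then 1 else 0
  | y :: y' :: γ => κ y' y * histWeight κ (y' :: γ)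

lemma histWeight_nonneg {κ : ℕ → ℕ → ℝ} {γ : List ℕ} (h : ∀ x ∈ γ.tail, ∀ y, 0 ≤ κ x y) :
    0 ≤ histWeight κ γ := by
  induction γ with
  | nil => exact le_rfl
  | cons y γ ih =>
    cases γ with
    | nil => simp only [histWeight]; split_ifs <;> norm_num
    | cons y' γ =>
      exact mul_nonneg (h _ (by simp) _) (ih fun x hx => h x (by
        simp only [List.tail_cons] at *; exact List.mem_cons_of_mem _ hx))

section Transition

variable {b w : ℕ → ℝ} {p : ℝ → ℕ → ℕ → ℝ}

lemma stepProb_nonneg (hbw : IsBranchingData b w) (x y : ℕ) : 0 ≤ stepProb b x y := by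
  unfold stepProb
  split_ifs with h
  · exact div_nonneg (hbw.nonneg _ (by omega)) (by linarith [hbw.neg])
  · exact le_rfl

lemma stepProb_shift (i j : ℕ) : stepProb b (i + 1) (i + j) =
    if j = 1 then 0 else b j / -b 1 := by
  unfold stepProb
  by_cases h : j = 1
  · rw [if_neg (by omega), if_pos h]
  · rw [if_pos (by omega), if_neg h, show i + j + 1 - (i + 1) = j by omega]

lemma hasSum_stepProb (hbw : IsBranchingData b w) {x : ℕ} (hx : x ≠ 0) :
    HasSum (stepProb b x) 1 := by
  obtain ⟨i, rfl⟩ := Nat.exists_eq_succ_of_ne_zero hx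
  rw [Nat.succ_eq_add_one, ← Function.Injective.hasSum_iff (add_right_injective i)]
  · have h := hbw.hasSum.div_const (-b 1)
    rw [div_self (by linarith [hbw.neg])] at h
    refine h.congr_fun fun j => ?_
    simp only [Function.comp_apply, stepProb_shift]
    split_ifs <;> simp
  · intro y hy
    unfold stepProb
    rw [if_neg]
    rintro ⟨_, h, _⟩
    exact hy ⟨y - i, by simp only; omega⟩

lemma tendsto_transition_div (hT : IsTransitionFunction p) (hF : ForwardEquation b w p) {x y : ℕ}
    (hy : y ≠ 0) : Filter.Tendsto (fun h => (p h x y - if x = y then 1 else 0) / h) (𝓝[>] 0)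
      (𝓝 (qMatrix b w x y)) := by
  have h := hF x y (Nat.one_le_iff_ne_zero.2 hy) 0 le_rfl
  have hq : ∑' k, p 0 x k * qMatrix b w k y = qMatrix b w x y := by
    rw [tsum_eq_single x]
    · simp [hT.zero]
    · intro k hk; simp [hT.zero, hk.symm]
  rw [hq] at h
  have h2 := (hasDerivWithinAt_iff_tendsto_slope' (by simp)).1 (h.mono Set.Ioi_subset_Ici_self)
  refine h2.congr fun s => ?_
  rw [slope_def_field, hT.zero, sub_zero]

lemma qMatrix_diag {x : ℕ} (hx : x ≠ 0) : qMatrix b w x x = w x * b 1 := by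
  unfold qMatrix
  rw [if_pos ⟨Nat.one_le_iff_ne_zero.2 hx, Nat.le_succ x⟩, Nat.add_sub_cancel_left]

lemma tendsto_escape_div (hT : IsTransitionFunction p) (hF : ForwardEquation b w p) {x : ℕ}
    (hx : x ≠ 0) : Filter.Tendsto (fun h => (1 - p h x x) / h) (𝓝[>] 0) (𝓝 (w x * -b 1)) := by
  have h := (tendsto_transition_div (x := x) hT hF hx).neg
  rw [qMatrix_diag hx, ← mul_neg] at h
  refine h.congr fun s => ?_
  simp only [if_true]; ring

lemma eventually_stay_lt_one (hbw : IsBranchingData b w) (hT : IsTransitionFunction p)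
    (hF : ForwardEquation b w p) {x : ℕ} (hx : x ≠ 0) : ∀ᶠ h in 𝓝[>] (0 : ℝ), p h x x < 1 := by
  have hpos : 0 < w x * -b 1 :=
    mul_pos (hbw.weight_pos x (Nat.one_le_iff_ne_zero.2 hx)) (by linarith [hbw.neg])
  filter_upwards [(tendsto_escape_div hT hF hx).eventually_const_lt hpos, self_mem_nhdsWithin]
    with h h1 h2
  have := (div_pos_iff_of_pos_right (show 0 < h from h2)).1 h1
  linarith

lemma tendsto_skelStep (hbw : IsBranchingData b w) (hT : IsTransitionFunction p)
    (hF : ForwardEquation b w p) {x y : ℕ} (hx : x ≠ 0) (hy : y ≠ 0) :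
    Filter.Tendsto (fun h => skelStep p h x y) (𝓝[>] 0) (𝓝 (stepProb b x y)) := by
  unfold skelStep
  by_cases hyx : y = x
  · simp only [if_pos hyx]
    rw [show stepProb b x y = 0 from if_neg (by tauto)]
    exact tendsto_const_nhds
  simp only [if_neg hyx]
  have hw := hbw.weight_pos x (Nat.one_le_iff_ne_zero.2 hx)
  have hpos : 0 < w x * -b 1 := mul_pos hw (by linarith [hbw.neg])
  have h1 := (tendsto_transition_div (x := x) hT hF hy).div (tendsto_escape_div hT hF hx) hpos.ne'
  have h2 : qMatrix b w x y / (w x * -b 1) = stepProb b x y := by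
    unfold qMatrix stepProb
    by_cases h : 1 ≤ x ∧ x ≤ y + 1
    · rw [if_pos h, if_pos ⟨h.1, h.2, hyx⟩, mul_div_mul_left _ _ hw.ne']
    · rw [if_neg h, if_neg (by tauto), zero_div]
  rw [h2] at h1
  refine h1.congr' ?_
  filter_upwards [self_mem_nhdsWithin] with h hh
  simp only [Pi.div_apply, if_neg (Ne.symm hyx), sub_zero]
  rw [div_div_div_cancel_right₀ (ne_of_gt hh)]

/-- The forward equations say nothing about the entrances into `0`; there the bound comes from the
total mass of the transition probabilities. -/
lemma eventually_skelStep_le (hbw : IsBranchingData b w) (hT : IsTransitionFunction p)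
    (hF : ForwardEquation b w p) {x : ℕ} (y : ℕ) (hx : x ≠ 0) {δ : ℝ} (hδ : 0 < δ) :
    ∀ᶠ h in 𝓝[>] (0 : ℝ), skelStep p h x y ≤ stepProb b x y + δ := by
  rcases eq_or_ne y 0 with rfl | hy
  swap
  · exact ((tendsto_skelStep hbw hT hF hx hy).eventually_lt_const (by linarith)).mono
      fun _ h => h.le
  have hlim := (hasSum_stepProb hbw hx).tendsto_sum_nat
  obtain ⟨N, hN⟩ := (hlim.eventually_const_lt (by linarith : 1 - δ < 1)).exists
  set A := (Finset.range N).erase 0 with hA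
  have hsum : 1 - δ < stepProb b x 0 + ∑ y ∈ A, stepProb b x y := by
    by_cases h0 : 0 ∈ Finset.range N
    · rwa [hA, Finset.add_sum_erase _ _ h0]
    · rw [hA, Finset.erase_eq_of_notMem h0]
      linarith [stepProb_nonneg hbw x 0]
  have htend : Filter.Tendsto (fun h => ∑ y ∈ A, skelStep p h x y) (𝓝[>] 0)
      (𝓝 (∑ y ∈ A, stepProb b x y)) :=
    tendsto_finsetSum _ fun y hy => tendsto_skelStep hbw hT hF hx (Finset.ne_of_mem_erase hy)
  filter_upwards [htend.eventually_const_lt (show 1 - δ - stepProb b x 0 < _ by linarith),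
    eventually_stay_lt_one hbw hT hF hx, self_mem_nhdsWithin] with h h1 h2 h3
  have h3' : 0 ≤ h := le_of_lt h3
  have hne : 0 < 1 - p h x x := by linarith
  have hle : p h x x + (p h x 0 + ∑ y ∈ A.erase x, p h x y) ≤ 1 := by
    have h0 : (0 : ℕ) ∉ A.erase x := by simp [hA]
    have hx' : x ∉ insert 0 (A.erase x) := by simp [hx]
    rw [← Finset.sum_insert h0, ← Finset.sum_insert hx']
    exact sum_le_hasSum _ (fun j _ => hT.nonneg h h3' x j) (hT.hasSum_one h h3' x)
  have hA2 : ∑ y ∈ A, skelStep p h x y = (∑ y ∈ A.erase x, p h x y) / (1 - p h x x) := by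
    rw [Finset.sum_div, ← Finset.sum_erase (s := A) (a := x) (f := fun y => skelStep p h x y)
      (by simp [skelStep])]
    exact Finset.sum_congr rfl fun y hy => by
      simp [skelStep, Finset.ne_of_mem_erase hy]
  have h4 : skelStep p h x 0 + ∑ y ∈ A, skelStep p h x y ≤ 1 := by
    rw [hA2]
    simp only [skelStep, if_neg (Ne.symm hx)]
    rw [← add_div, div_le_one hne]
    linarith
  linarith

lemma tendsto_histWeight (hbw : IsBranchingData b w) (hT : IsTransitionFunction p)
    (hF : ForwardEquation b w p) {γ : List ℕ} (hγ : 0 ∉ γ) :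
    Filter.Tendsto (fun h => histWeight (skelStep p h) γ) (𝓝[>] 0)
      (𝓝 (histWeight (stepProb b) γ)) := by
  induction γ with
  | nil => exact tendsto_const_nhds
  | cons y γ ih =>
    cases γ with
    | nil => exact tendsto_const_nhds
    | cons y' γ =>
      simp only [List.mem_cons, not_or] at hγ
      exact (tendsto_skelStep hbw hT hF (Ne.symm hγ.2.1) (Ne.symm hγ.1)).mul
        (ih (by simp only [List.mem_cons, not_or]; exact hγ.2))

end Transition

/-! ### The skeleton chains -/

/-- The event that the skeleton with mesh `h` has history `γ` at step `m`. -/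
def skelEvent {Ω : Type*} (X : ℝ≥0 → Ω → ℕ) (h : ℝ≥0) (γ : List ℕ) (m : ℕ) : Set Ω :=
  {ω | skelHist (fun i : ℕ => X (i * h) ω) m = γ}

lemma exists_skelEvent_eq {Ω : Type*} (X : ℝ≥0 → Ω → ℕ) (h : ℝ≥0) (γ : List ℕ) (m : ℕ) :
    ∃ A : Set (Fin (m + 1) → ℕ),
      skelEvent X h γ m = (fun ω (i : Fin (m + 1)) => X ((i : ℕ) * h) ω) ⁻¹' A := by
  refine ⟨{ξ | skelHist (fun i => if hi : i < m + 1 then ξ ⟨i, hi⟩ else 0) m = γ}, ?_⟩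
  ext ω
  have : skelHist (fun i : ℕ => X (i * h) ω) m =
      skelHist (fun i => if hi : i < m + 1 then X (i * h) ω else 0) m :=
    skelHist_congr fun i hi => by rw [dif_pos (Nat.lt_succ_of_le hi)]
  change _ = γ ↔ _ = γ
  rw [this]

section Chain

variable {Ω : Type*} [MeasurableSpace Ω] {P : Measure Ω} [IsProbabilityMeasure P]
  {X : ℝ≥0 → Ω → ℕ} {p : ℝ → ℕ → ℕ → ℝ}

lemma measurableSet_skelEvent (hX : ∀ t, Measurable (X t)) (h : ℝ≥0) (γ : List ℕ) (m : ℕ) :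
    MeasurableSet (skelEvent X h γ m) := by
  obtain ⟨A, hA⟩ := exists_skelEvent_eq X h γ m
  rw [hA]
  exact (measurable_pi_lambda _ fun i => hX _) A.to_countable.measurableSet

/-- The Markov property of a skeleton at step `m`, on an event determined by the first `m` steps
and contained in `{X (m * h) = x}`. -/
lemma measure_markov_step (hX : ∀ t, Measurable (X t))
    (hM : IsMarkovChain P X p) (h : ℝ≥0) (m x y : ℕ) {A : Set (Fin (m + 1) → ℕ)}
    (hA : ∀ ξ ∈ A, ξ (Fin.last m) = x) :
    P ((fun ω (i : Fin (m + 1)) => X ((i : ℕ) * h) ω) ⁻¹' A ∩ {ω | X ((m + 1 : ℕ) * h) ω = y}) =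
      P ((fun ω (i : Fin (m + 1)) => X ((i : ℕ) * h) ω) ⁻¹' A) * ENNReal.ofReal (p h x y) := by
  set Z : Ω → Fin (m + 1) → ℕ := fun ω i => X ((i : ℕ) * h) ω with hZ
  have hZm : Measurable Z := measurable_pi_lambda _ fun i => hX _
  have hEm : MeasurableSet {ω | X ((m + 1 : ℕ) * h) ω = y} := hX _ (measurableSet_singleton y)
  have hpt : ∀ ξ ∈ A, P (Z ⁻¹' {ξ} ∩ {ω | X ((m + 1 : ℕ) * h) ω = y}) =
      P (Z ⁻¹' {ξ}) * ENNReal.ofReal (p h x y) := by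
    intro ξ hξ
    set ξ' : ℕ → ℕ := fun i => if hi : i < m + 1 then ξ ⟨i, hi⟩ else y with hξ'
    have hmono : Monotone fun i : ℕ => (i : ℝ≥0) * h := fun i j hij => by
      have : (i : ℝ≥0) ≤ j := by exact_mod_cast hij
      simp only; gcongr
    have hsub : ∀ i : ℕ,
        ((((i + 1 : ℕ) : ℝ≥0) * h : ℝ≥0) : ℝ) - (((i : ℝ≥0) * h : ℝ≥0) : ℝ) = h := by
      intro i; push_cast; ring
    have h1 := hM m (fun i => i * h) ξ' (by simp) hmono
    have h2 := hM (m + 1) (fun i => i * h) ξ' (by simp) hmono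
    rw [Finset.prod_range_succ, ← mul_assoc, ← h1, hsub] at h2
    have e1 : {ω | ∀ i ≤ m, X ((i : ℕ) * h) ω = ξ' i} = Z ⁻¹' {ξ} := by
      ext ω
      simp only [Set.mem_ofPred_eq, Set.mem_preimage, Set.mem_singleton_iff]
      constructor
      · intro hω; funext i
        have h3 := hω i (Nat.lt_succ_iff.1 i.2)
        rwa [show ξ' i = ξ i from dif_pos i.2] at h3
      · rintro rfl i hi
        have h3 : ξ' i = Z ω ⟨i, Nat.lt_succ_of_le hi⟩ := dif_pos (Nat.lt_succ_of_le hi)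
        exact h3.symm
    have e2 : {ω | ∀ i ≤ m + 1, X ((i : ℕ) * h) ω = ξ' i} =
        Z ⁻¹' {ξ} ∩ {ω | X ((m + 1 : ℕ) * h) ω = y} := by
      rw [← e1]
      ext ω
      simp only [Set.mem_ofPred_eq, Set.mem_inter_iff]
      constructor
      · intro hω
        refine ⟨fun i hi => hω i (by omega), ?_⟩
        have := hω (m + 1) le_rfl
        simpa [hξ'] using this
      · rintro ⟨h1, h2⟩ i hi
        rcases Nat.lt_or_ge m i with hlt | hle
        · obtain rfl : i = m + 1 := by omega
          simpa [hξ'] using h2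
        · exact h1 i hle
    have e3 : ξ' m = x := (dif_pos (Nat.lt_succ_self m)).trans (hA ξ hξ)
    have e4 : ξ' (m + 1) = y := by simp [hξ']
    rw [e1, e2, e3, e4] at h2
    rw [← ENNReal.ofReal_toReal (measure_ne_top P (Z ⁻¹' {ξ})), ← ENNReal.ofReal_mul
      ENNReal.toReal_nonneg, ← ENNReal.ofReal_toReal (measure_ne_top P (_ ∩ _))]
    exact congrArg ENNReal.ofReal h2
  have hU : Z ⁻¹' A = ⋃ ξ ∈ A, Z ⁻¹' {ξ} := by
    rw [← Set.preimage_iUnion₂, Set.biUnion_of_singleton]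
  have hdisj : ∀ B : Set Ω, A.PairwiseDisjoint fun ξ => Z ⁻¹' {ξ} ∩ B := fun B ξ _ ξ' _ hne =>
    Set.disjoint_left.2 fun ω h1 h2 => hne (h1.1.symm.trans h2.1)
  have hcount := A.to_countable
  have hsum := measure_biUnion (μ := P) hcount (hdisj {ω | X ((m + 1 : ℕ) * h) ω = y})
    fun ξ _ => (hZm (measurableSet_singleton ξ)).inter hEm
  have hsum' := measure_biUnion (μ := P) hcount (hdisj Set.univ)
    fun ξ _ => (hZm (measurableSet_singleton ξ)).inter MeasurableSet.univ
  simp only [Set.inter_univ] at hsum'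
  rw [hU, Set.iUnion₂_inter, hsum, hsum', ← ENNReal.tsum_mul_right]
  exact tsum_congr fun ξ => hpt ξ ξ.2

lemma measure_skelEvent_step (hX : ∀ t, Measurable (X t))
    (hM : IsMarkovChain P X p) (h : ℝ≥0) (m x y : ℕ) (γ : List ℕ) :
    P (skelEvent X h (x :: γ) m ∩ {ω | X ((m + 1 : ℕ) * h) ω = y}) =
      P (skelEvent X h (x :: γ) m) * ENNReal.ofReal (p h x y) := by
  obtain ⟨A, hA⟩ := exists_skelEvent_eq X h (x :: γ) m
  have hsub : skelEvent X h (x :: γ) m ⊆ {ω | X (m * h) ω = x} := by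
    intro ω hω
    obtain ⟨γ', hγ'⟩ := skelHist_eq_cons (fun i : ℕ => X (i * h) ω) m
    have : X (m * h) ω :: γ' = x :: γ := hγ'.symm.trans hω
    exact (List.cons.inj this).1
  have hA' : skelEvent X h (x :: γ) m =
      (fun ω (i : Fin (m + 1)) => X ((i : ℕ) * h) ω) ⁻¹' (A ∩ {ξ | ξ (Fin.last m) = x}) := by
    rw [Set.preimage_inter, ← hA]
    refine (Set.inter_eq_left.2 fun ω hω => ?_).symm
    simpa using hsub hω
  rw [hA']
  exact measure_markov_step hX hM h m x y fun ξ hξ => hξ.2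

end Chain

lemma skelHist_succ_eq_singleton {z : ℕ → ℕ} {m y : ℕ} (h : skelHist z (m + 1) = [y]) :
    skelHist z m = [y] ∧ z (m + 1) = y := by
  obtain ⟨γ, hγ⟩ := skelHist_eq_cons z m
  rw [skelHist] at h
  split_ifs at h with h1
  · refine ⟨h, ?_⟩
    rw [hγ] at h
    rw [h1, (List.cons.inj h).1]
  · rw [hγ] at h
    exact absurd (List.cons.inj h).2 (by simp)

lemma skelHist_succ_eq_cons {z : ℕ → ℕ} {m y y' : ℕ} {γ : List ℕ}
    (h : skelHist z (m + 1) = y :: y' :: γ) :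
    (skelHist z m = y' :: γ ∧ z (m + 1) = y ∧ y ≠ y') ∨
      (skelHist z m = y :: y' :: γ ∧ z (m + 1) = y) := by
  obtain ⟨γ', hγ⟩ := skelHist_eq_cons z m
  rw [skelHist] at h
  split_ifs at h with h1
  · refine Or.inr ⟨h, ?_⟩
    rw [hγ] at h
    rw [h1, (List.cons.inj h).1]
  · obtain ⟨h2, h3⟩ := List.cons.inj h
    refine Or.inl ⟨h3, h2, ?_⟩
    rw [hγ] at h3
    rw [← h2, ← (List.cons.inj h3).1]
    exact h1

lemma one_sub_mul_sum_le {u e : ℕ → ℝ} {q : ℝ} (hu : ∀ m, 0 ≤ u m) (he : ∀ m, 0 ≤ e m)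
    (hq : 0 ≤ q) (h : ∀ m, u (m + 1) ≤ e m + u m * q) (M : ℕ) :
    (1 - q) * ∑ m ∈ Finset.range M, u m ≤ u 0 + ∑ m ∈ Finset.range M, e m := by
  cases M with
  | zero => simpa using hu 0
  | succ M =>
    have h1 : ∑ m ∈ Finset.range M, u (m + 1) ≤
        ∑ m ∈ Finset.range M, e m + (∑ m ∈ Finset.range M, u m) * q := by
      rw [Finset.sum_mul, ← Finset.sum_add_distrib]
      exact Finset.sum_le_sum fun m _ => h m
    have h2 : (∑ m ∈ Finset.range M, u m) * q ≤ (∑ m ∈ Finset.range (M + 1), u m) * q := by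
      refine mul_le_mul_of_nonneg_right ?_ hq
      rw [Finset.sum_range_succ]; linarith [hu M]
    have h3 := Finset.sum_range_succ' u M
    have h4 := Finset.sum_range_succ e M
    have h5 := he M
    linarith

lemma measure_eventually_le {Ω : Type*} [MeasurableSpace Ω] {P : Measure Ω}
    {E : ℕ → Set Ω} {a : ℝ≥0∞}
    (h : ∀ᶠ n in Filter.atTop, P (E n) ≤ a) : P {ω | ∀ᶠ n in Filter.atTop, ω ∈ E n} ≤ a := by
  have hU : {ω | ∀ᶠ n in Filter.atTop, ω ∈ E n} = ⋃ N, ⋂ n ≥ N, E n := by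
    ext ω; simp [Filter.eventually_atTop]
  have hmono : Monotone fun N => ⋂ n ≥ N, E n := fun N N' hN =>
    Set.biInter_subset_biInter_left fun n hn => le_trans hN hn
  rw [hU, hmono.measure_iUnion]
  refine iSup_le fun N => ?_
  obtain ⟨n, hn, hNn⟩ := (h.and (Filter.eventually_ge_atTop N)).exists
  exact (measure_mono (Set.biInter_subset_of_mem hNn)).trans hn

section Occupation

variable {Ω : Type*} [MeasurableSpace Ω] {P : Measure Ω} [IsProbabilityMeasure P]
  {X : ℝ≥0 → Ω → ℕ} {p : ℝ → ℕ → ℕ → ℝ}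

lemma measureReal_skelEvent_step (hX : ∀ t, Measurable (X t)) (hT : IsTransitionFunction p)
    (hM : IsMarkovChain P X p) (h : ℝ≥0) (m x y : ℕ) (γ : List ℕ) :
    P.real (skelEvent X h (x :: γ) m ∩ {ω | X ((m + 1 : ℕ) * h) ω = y}) =
      P.real (skelEvent X h (x :: γ) m) * p h x y := by
  rw [measureReal_def, measure_skelEvent_step hX hM, ENNReal.toReal_mul,
    ENNReal.toReal_ofReal (hT.nonneg h h.2 x y)]
  rfl

/-- A bound for the expected time that a skeleton spends with a given history: the history is
entered at most once, and then held for a geometric time. -/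
lemma one_sub_mul_sum_skelEvent_le (hX : ∀ t, Measurable (X t)) (hT : IsTransitionFunction p)
    (hM : IsMarkovChain P X p) (hX0 : ∀ᵐ ω ∂P, X 0 ω = 1) (h : ℝ≥0) (y : ℕ) (γ : List ℕ)
    (hγ : ∀ x ∈ γ, p h x x < 1) (M : ℕ) :
    (1 - p h y y) * ∑ m ∈ Finset.range M, P.real (skelEvent X h (y :: γ) m) ≤
      histWeight (skelStep p h) (y :: γ) := by
  have hnn := fun x y => hT.nonneg h h.2 x y
  induction γ generalizing y M with
  | nil =>
    have h0 : P.real (skelEvent X h [y] 0) ≤ histWeight (skelStep p h) [y] := by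
      simp only [histWeight]
      split_ifs with hy
      · exact measureReal_le_one
      · refine le_of_eq ?_
        rw [measureReal_def, ENNReal.toReal_eq_zero_iff]
        refine Or.inl (measure_mono_null (fun ω hω => ?_) hX0)
        have : [X ((0 : ℕ) * h) ω] = [y] := hω
        have h2 := (List.cons.inj this).1
        simp only [Nat.cast_zero, zero_mul] at h2
        intro h3
        exact hy (h2.symm.trans h3)
    refine (one_sub_mul_sum_le (e := fun _ => 0) (fun _ => measureReal_nonneg) (fun _ => le_rfl)
      (hnn y y) (fun m => ?_) M).trans ?_
    · rw [zero_add, ← measureReal_skelEvent_step hX hT hM]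
      exact measureReal_mono fun ω hω => skelHist_succ_eq_singleton hω
    · simpa using h0
  | cons y' γ ih =>
    have h1 : 0 < 1 - p h y' y' := by linarith [hγ y' (by simp)]
    have h0 : P.real (skelEvent X h (y :: y' :: γ) 0) = 0 := by
      rw [show skelEvent X h (y :: y' :: γ) 0 = ∅ from
        Set.eq_empty_of_forall_notMem fun ω hω => by simp [skelEvent, skelHist] at hω]
      simp
    refine (one_sub_mul_sum_le (e := fun m => if y = y' then 0 else
      P.real (skelEvent X h (y' :: γ) m) * p h y' y) (fun _ => measureReal_nonneg) (fun m => ?_)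
      (hnn y y) (fun m => ?_) M).trans ?_
    · split_ifs
      · exact le_rfl
      · exact mul_nonneg measureReal_nonneg (hnn _ _)
    · split_ifs with hy
      · rw [zero_add, ← measureReal_skelEvent_step hX hT hM]
        refine measureReal_mono fun ω hω => ?_
        rcases skelHist_succ_eq_cons hω with h2 | h2
        · exact absurd hy h2.2.2
        · exact h2
      · rw [← measureReal_skelEvent_step hX hT hM, ← measureReal_skelEvent_step hX hT hM]
        refine le_trans (measureReal_mono fun ω hω => ?_) (measureReal_union_le _ _)
        rcases skelHist_succ_eq_cons hω with h2 | h2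
        · exact Or.inl ⟨h2.1, h2.2.1⟩
        · exact Or.inr h2
    · rw [h0, zero_add]
      have hW := ih y' (fun x hx => hγ x (List.mem_cons_of_mem _ hx)) M
      simp only [histWeight, skelStep]
      split_ifs with hy
      · simp
      · rw [← Finset.sum_mul, div_mul_eq_mul_div, le_div_iff₀ h1]
        have := mul_le_mul_of_nonneg_left hW (hnn y' y)
        linarith

/-- The probability that a skeleton has the history `γ` at some step is at most the product of its
step probabilities given that the current state is left. -/
lemma measure_exists_skelEvent_le (hX : ∀ t, Measurable (X t)) (hT : IsTransitionFunction p)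
    (hM : IsMarkovChain P X p) (hX0 : ∀ᵐ ω ∂P, X 0 ω = 1) (h : ℝ≥0) (γ : List ℕ)
    (hγ : ∀ x ∈ γ.tail, p h x x < 1) :
    P {ω | ∃ m, ω ∈ skelEvent X h γ m} ≤ ENNReal.ofReal (histWeight (skelStep p h) γ) := by
  have hnn := fun x y => hT.nonneg h h.2 x y
  match γ, hγ with
  | [], _ =>
    refine le_of_eq_of_le (measure_mono_null (t := ∅) ?_ measure_empty) zero_le
    rintro ω ⟨m, hω⟩
    obtain ⟨γ, hγ⟩ := skelHist_eq_cons (fun i : ℕ => X (i * h) ω) m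
    have : skelHist (fun i : ℕ => X (i * h) ω) m = [] := hω
    rw [hγ] at this
    exact absurd this (by simp)
  | [y], _ =>
    simp only [histWeight]
    split_ifs with hy
    · simpa using prob_le_one
    · refine le_of_eq_of_le (measure_mono_null ?_ hX0) zero_le
      rintro ω ⟨m, hω⟩
      have h0 : skelHist (fun i : ℕ => X (i * h) ω) 0 = [y] := by
        induction m with
        | zero => exact hω
        | succ m ih => exact ih (skelHist_succ_eq_singleton hω).1
      simp only [skelHist, Nat.cast_zero, zero_mul] at h0
      exact fun h3 => hy ((List.cons.inj h0).1.symm.trans h3)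
  | y :: y' :: γ, hγ =>
    simp only [List.tail_cons] at hγ
    have h1 : 0 < 1 - p h y' y' := by linarith [hγ y' (by simp)]
    have hsub : {ω | ∃ m, ω ∈ skelEvent X h (y :: y' :: γ) m} ⊆
        ⋃ m, {ω | ω ∈ skelEvent X h (y' :: γ) m ∩ {ω | X ((m + 1 : ℕ) * h) ω = y} ∧ y ≠ y'} := by
      rintro ω ⟨m, hω⟩
      induction m with
      | zero => simp [skelEvent, skelHist] at hω
      | succ m ih =>
        rcases skelHist_succ_eq_cons hω with h2 | h2
        · exact Set.mem_iUnion.2 ⟨m, ⟨h2.1, h2.2.1⟩, h2.2.2⟩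
        · exact ih h2.1
    refine (measure_mono hsub).trans ((measure_iUnion_le _).trans ?_)
    by_cases hy : y = y'
    · simp [hy]
    simp only [ne_eq, hy, not_false_eq_true, and_true, Set.ofPred_mem_eq]
    refine ENNReal.tsum_le_of_sum_range_le fun M => ?_
    have hW := one_sub_mul_sum_skelEvent_le hX hT hM hX0 h y' γ
      (fun x hx => hγ x (List.mem_cons_of_mem _ hx)) M
    rw [← ENNReal.ofReal_toReal (ENNReal.sum_ne_top.2 fun m _ => measure_ne_top P _),
      ENNReal.toReal_sum fun m _ => measure_ne_top P _]
    refine ENNReal.ofReal_le_ofReal ?_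
    simp only [← measureReal_def, measureReal_skelEvent_step hX hT hM, histWeight, skelStep,
      if_neg hy]
    rw [← Finset.sum_mul, div_mul_eq_mul_div, le_div_iff₀ h1]
    have := mul_le_mul_of_nonneg_left hW (hnn y' y)
    linarith

/-- The meshes of the skeletons. -/
noncomputable def mesh (n : ℕ) : ℝ≥0 := 1 / ((n : ℝ≥0) + 1)

lemma mesh_pos (n : ℕ) : 0 < mesh n := by unfold mesh; positivity

lemma tendsto_mesh : Filter.Tendsto mesh Filter.atTop (𝓝 0) :=
  tendsto_one_div_add_atTop_nhds_zero_nat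

lemma tendsto_mesh_real : Filter.Tendsto (fun n => (mesh n : ℝ)) Filter.atTop (𝓝[>] 0) :=
  tendsto_nhdsWithin_iff.2 ⟨by simpa using NNReal.tendsto_coe.2 tendsto_mesh,
    Filter.Eventually.of_forall fun n => NNReal.coe_pos.2 (mesh_pos n)⟩

/-- The event that all sufficiently fine skeletons have the history `γ` at some step. -/
def fineEvent (X : ℝ≥0 → Ω → ℕ) (γ : List ℕ) : Set Ω :=
  {ω | ∀ᶠ n in Filter.atTop, ω ∈ {ω | ∃ m, ω ∈ skelEvent X (mesh n) γ m}}

lemma measurableSet_fineEvent (hX : ∀ t, Measurable (X t)) (γ : List ℕ) :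
    MeasurableSet (fineEvent X γ) := by
  have hU : fineEvent X γ = ⋃ N, ⋂ n ≥ N, ⋃ m, skelEvent X (mesh n) γ m := by
    ext ω; simp [fineEvent, Filter.eventually_atTop]
  rw [hU]
  exact .iUnion fun N => .iInter fun n => .iInter fun _ => .iUnion fun m =>
    measurableSet_skelEvent hX _ _ _

lemma measure_fineEvent_le {b w : ℕ → ℝ} (hbw : IsBranchingData b w)
    (hX : ∀ t, Measurable (X t)) (hT : IsTransitionFunction p) (hF : ForwardEquation b w p)
    (hM : IsMarkovChain P X p) (hX0 : ∀ᵐ ω ∂P, X 0 ω = 1) {γ : List ℕ} (hγ : 0 ∉ γ.tail) :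
    P (fineEvent X γ) ≤ ENNReal.ofReal (histWeight (stepProb b) γ) := by
  have hstay : ∀ᶠ h in 𝓝[>] (0 : ℝ), ∀ x ∈ γ.tail, p h x x < 1 := by
    have := (Filter.eventually_all_finset (l := 𝓝[>] (0 : ℝ)) γ.tail.toFinset
      (p := fun x h => p h x x < 1)).2 fun x hx => eventually_stay_lt_one hbw hT hF
        fun h0 => hγ (h0 ▸ List.mem_toFinset.1 hx)
    simpa only [List.mem_toFinset] using this
  have hbound := tendsto_mesh_real.eventually hstay |>.mono fun n hn =>
    measure_exists_skelEvent_le hX hT hM hX0 (mesh n) γ hn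
  match γ, hγ with
  | [], _ => exact measure_eventually_le hbound
  | [y], _ => exact measure_eventually_le hbound
  | y :: y' :: γ, hγ =>
    simp only [List.tail_cons] at hγ
    have hy' : y' ≠ 0 := fun h => hγ (by simp [h])
    set κ := stepProb b y' y with hκ
    set W := histWeight (stepProb b) (y' :: γ) with hW
    have hκ0 : 0 ≤ κ := stepProb_nonneg hbw _ _
    have hδ : ∀ δ > 0, P (fineEvent X (y :: y' :: γ)) ≤ ENNReal.ofReal ((κ + δ) * (W + δ)) := by
      intro δ hδ
      refine measure_eventually_le ?_
      filter_upwards [hbound, tendsto_mesh_real.eventually hstay,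
        tendsto_mesh_real.eventually (eventually_skelStep_le hbw hT hF y hy' hδ),
        tendsto_mesh_real.eventually ((tendsto_histWeight hbw hT hF hγ).eventually_lt_const
          (show W < W + δ by linarith))] with n h1 h2 h3 h4
      refine h1.trans (ENNReal.ofReal_le_ofReal ?_)
      have h5 : 0 ≤ histWeight (skelStep p (mesh n)) (y' :: γ) := by
        refine histWeight_nonneg fun x hx z => ?_
        unfold skelStep
        split_ifs
        · exact le_rfl
        · exact div_nonneg (hT.nonneg _ (mesh n).2 _ _) (sub_nonneg.2 (h2 x (by
            simp only [List.tail_cons] at *; exact List.mem_cons_of_mem _ hx)).le)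
      exact mul_le_mul h3 h4.le h5 (by linarith)
    have hlim : Filter.Tendsto (fun δ : ℝ => ENNReal.ofReal ((κ + δ) * (W + δ))) (𝓝[>] 0)
        (𝓝 (ENNReal.ofReal (κ * W))) := by
      have : Continuous fun δ : ℝ => ENNReal.ofReal ((κ + δ) * (W + δ)) :=
        ENNReal.continuous_ofReal.comp (by fun_prop)
      have h2 := this.tendsto 0
      simp only [add_zero] at h2
      exact h2.mono_left nhdsWithin_le_nhds
    exact ge_of_tendsto hlim (Filter.eventually_of_mem self_mem_nhdsWithin hδ)

/-- The process almost surely leaves every state `y ≠ 0` that it visits. -/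
lemma ae_not_stuck {b w : ℕ → ℝ} (hbw : IsBranchingData b w) (hT : IsTransitionFunction p)
    (hF : ForwardEquation b w p) (hM : IsMarkovChain P X p) (hX0 : ∀ᵐ ω ∂P, X 0 ω = 1) :
    ∀ᵐ ω ∂P, ∀ t, X t ω ≠ 0 → ∃ u > t, X u ω ≠ X t ω := by
  have hle : ∀ s, 0 ≤ s → ∀ i j, p s i j ≤ 1 := fun s hs i j =>
    le_hasSum (hT.hasSum_one s hs i) j fun k _ => hT.nonneg s hs i k
  have key : ∀ y ≠ 0, ∀ N : ℕ, ∀ᵐ ω ∂P, ¬ ∀ u : ℝ≥0, N ≤ u → X u ω = y := by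
    intro y hy N
    obtain ⟨h, hp, hh⟩ := ((eventually_stay_lt_one hbw hT hF hy).and self_mem_nhdsWithin).exists
    have hh0 : 0 ≤ h := le_of_lt hh
    lift h to ℝ≥0 using hh0
    have hp0 := hT.nonneg h h.2 y y
    set t : ℕ → ℝ≥0 := fun m => if m = 0 then 0 else N + (m - 1 : ℕ) * h with ht
    set x : ℕ → ℕ := fun m => if m = 0 then 1 else y with hx
    have htm : Monotone t := by
      refine monotone_nat_of_le_succ fun m => ?_
      cases m with
      | zero => simp [ht]
      | succ m => simp only [ht, Nat.add_eq_zero_iff, one_ne_zero, and_false, if_false,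
          Nat.add_sub_cancel]; gcongr; simp
    have hbd : ∀ M : ℕ, P {ω | ∀ u : ℝ≥0, N ≤ u → X u ω = y} ≤ ENNReal.ofReal (p h y y ^ M) := by
      intro M
      have h1 := hM (M + 1) t x (by simp [ht]) htm
      have h2 : P.real {ω | ∀ m ≤ M + 1, X (t m) ω = x m} ≤ p h y y ^ M := by
        rw [h1, Finset.prod_range_succ']
        have h3 : ∀ m ∈ Finset.range M, p ((t (m + 1 + 1) : ℝ) - t (m + 1)) (x (m + 1))
            (x (m + 1 + 1)) = p h y y := fun m _ => by
          simp only [ht, hx, Nat.add_eq_zero_iff, one_ne_zero, and_false, if_false,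
            Nat.add_sub_cancel]
          congr 1; push_cast; ring
        rw [Finset.prod_congr rfl h3, Finset.prod_const, Finset.card_range]
        have hs : 0 ≤ (t (0 + 1) : ℝ) - t 0 := by
          rw [sub_nonneg]; exact_mod_cast htm (Nat.zero_le _)
        have h4 := hT.nonneg _ hs (x 0) (x (0 + 1))
        have h5 := mul_le_of_le_one_right (pow_nonneg hp0 M) (hle _ hs (x 0) (x (0 + 1)))
        exact (mul_le_of_le_one_left (mul_nonneg (pow_nonneg hp0 M) h4)
          measureReal_le_one).trans h5
      refine (measure_mono_ae ?_).trans ((ENNReal.ofReal_toReal (measure_ne_top P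
        {ω | ∀ m ≤ M + 1, X (t m) ω = x m})).symm.le.trans (ENNReal.ofReal_le_ofReal h2))
      filter_upwards [hX0] with ω h0 hω m _
      cases m with
      | zero => simpa [ht, hx] using h0
      | succ m => exact hω _ (by simp [ht])
    have h0 : P {ω | ∀ u : ℝ≥0, N ≤ u → X u ω = y} = 0 := by
      refine le_antisymm (ge_of_tendsto' (x := Filter.atTop) ?_ hbd) zero_le
      have := ENNReal.tendsto_ofReal (tendsto_pow_atTop_nhds_zero_of_lt_one hp0 hp)
      simpa using this
    rw [ae_iff]
    simpa only [not_not] using h0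
  have hall : ∀ᵐ ω ∂P, ∀ y N : ℕ, y ≠ 0 → ¬ ∀ u : ℝ≥0, N ≤ u → X u ω = y := by
    rw [ae_all_iff]; intro y
    rw [ae_all_iff]; intro N
    by_cases hy : y = 0
    · simp [hy]
    · filter_upwards [key y hy N] with ω h _ using h
  filter_upwards [hall] with ω hω t ht
  by_contra! hcon
  refine hω (X t ω) ⌈t⌉₊ ht fun u hu => ?_
  rcases ((Nat.le_ceil t).trans hu).eq_or_lt with rfl | hlt
  · rfl
  · exact hcon u hlt

end Occupation

/-! ### The law of the stopped jump history -/

section HistoryLaw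

variable {b w : ℕ → ℝ} {S : Finset ℕ}

/-- The offspring law as a probability mass function. -/
noncomputable def jumpPMF (hbw : IsBranchingData b w) : PMF ℕ :=
  ⟨jumpLaw b, ENNReal.summable.hasSum_iff.2 (jumpLaw_tsum hbw)⟩

/-- One more jump of a history with the latest state first; `0` is absorbing. -/
noncomputable def extendHist (hbw : IsBranchingData b w) : List ℕ → PMF (List ℕ)
  | [] => PMF.pure []
  | 0 :: γ => PMF.pure (0 :: γ)
  | (i + 1) :: γ => (jumpPMF hbw).map fun j => (i + j) :: (i + 1) :: γ

/-- The law of the history of the embedded jump chain from `1`, stopped at `0` and after `n`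
jumps. -/
noncomputable def histPMF (hbw : IsBranchingData b w) : ℕ → PMF (List ℕ)
  | 0 => PMF.pure [1]
  | n + 1 => (histPMF hbw n).bind (extendHist hbw)

/-- On stopped histories the law of the jump chain dominates the product of the step
probabilities. -/
lemma histWeight_le_histPMF (hbw : IsBranchingData b w) {n : ℕ} {γ : List ℕ}
    (hγ : IsStopped n γ) : ENNReal.ofReal (histWeight (stepProb b) γ) ≤ histPMF hbw n γ := by
  induction n generalizing γ with
  | zero =>
    match γ, hγ with
    | [], _ => simp [histWeight]
    | [y], _ =>
      simp only [histWeight, histPMF, PMF.pure_apply]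
      by_cases hy : y = 1 <;> simp [hy]
    | y :: y' :: γ, hγ => exact absurd hγ.2.1 (by simp)
  | succ n ih =>
    have hterm : ∀ γ', histPMF hbw n γ' * extendHist hbw γ' γ ≤ histPMF hbw (n + 1) γ := by
      intro γ'
      rw [histPMF, PMF.bind_apply]
      exact ENNReal.le_tsum γ'
    by_cases hcase : γ.length ≤ n + 1
    · have hhead : γ.head? = some 0 := hγ.2.2.resolve_left (by omega)
      have hst : IsStopped n γ := ⟨hγ.1, hcase, Or.inr hhead⟩
      refine (ih hst).trans (le_of_eq_of_le ?_ (hterm γ))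
      obtain ⟨γ', rfl⟩ : ∃ γ', γ = 0 :: γ' := by
        cases γ with
        | nil => simp at hhead
        | cons a γ => exact ⟨γ, by simpa using hhead⟩
      simp [extendHist]
    · match γ, hγ, hcase with
      | [], _, hcase => exact absurd hcase (by simp)
      | [y], _, hcase => exact absurd hcase (by simp)
      | y :: 0 :: γ, hγ, _ => exact absurd hγ.1 (by simp)
      | y :: (i + 1) :: γ, hγ, hcase =>
        have hl := hγ.2.1
        simp only [List.length_cons] at hl hcase
        have hst : IsStopped n ((i + 1) :: γ) := by
          refine ⟨fun h => hγ.1 (List.mem_cons_of_mem _ h), ?_, Or.inl ?_⟩ <;>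
            simp only [List.length_cons] <;> omega
        refine le_trans ?_ (hterm ((i + 1) :: γ))
        rw [histWeight, mul_comm, ENNReal.ofReal_mul' (stepProb_nonneg hbw _ _)]
        refine mul_le_mul' (ih hst) ?_
        by_cases hi : i ≤ y
        · obtain ⟨j, rfl⟩ := Nat.exists_eq_add_of_le hi
          rw [extendHist, PMF.map_apply, stepProb_shift]
          refine le_trans (le_of_eq ?_) (ENNReal.le_tsum j)
          rw [if_pos rfl]
          change _ = jumpLaw b j
          unfold jumpLaw; split_ifs <;> simp
        · rw [stepProb, if_neg (by omega)]; simp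

/-- The weight, beyond the history `γ`, of hitting `0` within `k` more moves with total crossing
numbers `l`. -/
noncomputable def remWeight (b : ℕ → ℝ) (S : Finset ℕ) (k : ℕ) (l : S → ℕ) (γ : List ℕ) : ℝ≥0∞ :=
  shift (crossCount S γ) (hitWeight (jumpLaw b) (mark S) k (γ.headD 0)) l

lemma tsum_extendHist_mul_remWeight (hbw : IsBranchingData b w) (k : ℕ) (l : S → ℕ)
    (γ : List ℕ) :
    ∑' γ', extendHist hbw γ γ' * remWeight b S k l γ' = remWeight b S (k + 1) l γ := by
  have hpure : ∀ γ : List ℕ, ∑' γ', PMF.pure γ γ' * remWeight b S k l γ' =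
      remWeight b S k l γ := fun γ => by
    rw [tsum_eq_single γ]
    · simp
    · intro γ' h; simp [PMF.pure_apply, h]
  match γ with
  | [] =>
    rw [extendHist, hpure]
    simp only [remWeight, List.headD_nil, hitWeight_at_zero]
  | 0 :: γ =>
    rw [extendHist, hpure]
    simp only [remWeight, List.headD_cons, hitWeight_at_zero]
  | (i + 1) :: γ =>
    have hmap : ∀ γ', extendHist hbw ((i + 1) :: γ) γ' * remWeight b S k l γ' =
        ∑' j, (if γ' = (i + j) :: (i + 1) :: γ then jumpLaw b j * remWeight b S k l γ' else 0) :=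
        fun γ' => by
      rw [extendHist, PMF.map_apply, ← ENNReal.tsum_mul_right]
      refine tsum_congr fun j => ?_
      by_cases h : γ' = (i + j) :: (i + 1) :: γ
      · rw [if_pos h, if_pos h]; rfl
      · rw [if_neg h, if_neg h, zero_mul]
    simp_rw [hmap]
    rw [ENNReal.tsum_comm]
    have hinner : ∀ j, ∑' γ', (if γ' = (i + j) :: (i + 1) :: γ then
        jumpLaw b j * remWeight b S k l γ' else 0) =
        jumpLaw b j * remWeight b S k l ((i + j) :: (i + 1) :: γ) := fun j => by
      rw [tsum_eq_single ((i + j) :: (i + 1) :: γ)]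
      · simp
      · intro γ' h; simp [h]
    simp_rw [hinner]
    have hcount : ∀ j, crossCount S ((i + j) :: (i + 1) :: γ) =
        crossCount S ((i + 1) :: γ) + mark S j := fun j => by
      funext k
      have : i + j + 1 = i + 1 + (k : ℕ) ↔ (k : ℕ) = j := by omega
      simp only [crossCount, this, Pi.add_apply, mark]
      rw [add_comm]
    unfold remWeight
    simp only [List.headD_cons, hcount, shift_add]
    have hrec : hitWeight (jumpLaw b) (mark S) (k + 1) (i + 1) = fun l =>
        ∑' j, jumpLaw b j * shift (mark S j) (hitWeight (jumpLaw b) (mark S) k (i + j)) l := rfl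
    rw [hrec, shift_tsum]
    exact tsum_congr fun j => (shift_const_mul _ _ _ _).symm

/-- Chapman–Kolmogorov for the jump chain: `n` moves followed by `k` moves. -/
lemma tsum_histPMF_mul_remWeight (hbw : IsBranchingData b w) (n k : ℕ) (l : S → ℕ) :
    ∑' γ, histPMF hbw n γ * remWeight b S k l γ =
      hitWeight (jumpLaw b) (mark S) (n + k) 1 l := by
  induction n generalizing k with
  | zero =>
    rw [tsum_eq_single [1]]
    · have : crossCount S [1] = 0 := rfl
      simp [histPMF, remWeight, this]
    · intro γ h; simp [histPMF, PMF.pure_apply, h]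
  | succ n ih =>
    simp only [histPMF, PMF.bind_apply]
    simp_rw [← ENNReal.tsum_mul_right]
    rw [ENNReal.tsum_comm]
    simp_rw [mul_assoc, ENNReal.tsum_mul_left, tsum_extendHist_mul_remWeight]
    rw [ih, show n + (k + 1) = n + 1 + k by ring]

open Classical in
/-- The stopped histories that end at `0` with crossing numbers `l` have total weight
`hitWeight n 1 l`. -/
lemma tsum_histPMF_extinct (hbw : IsBranchingData b w) (n : ℕ) (l : S → ℕ) :
    ∑' γ, (if γ.headD 0 = 0 ∧ crossCount S γ = l then histPMF hbw n γ else 0) =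
      hitWeight (jumpLaw b) (mark S) n 1 l := by
  rw [← add_zero n, ← tsum_histPMF_mul_remWeight hbw n 0 l, add_zero]
  refine tsum_congr fun γ => ?_
  unfold remWeight
  have hsh : shift (crossCount S γ) unitCoeff l = if crossCount S γ = l then 1 else 0 := by
    unfold shift unitCoeff
    by_cases h : crossCount S γ = l
    · simp [h]
    · rw [if_neg h]
      split_ifs with h1 h2
      · exact absurd (le_antisymm h1 (tsub_eq_zero_iff_le.1 h2)) h
      · rfl
      · rfl
  cases hh : γ.headD 0 with
  | zero => rw [hitWeight_at_zero, hsh]; by_cases h : crossCount S γ = l <;> simp [h]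
  | succ i => simp [hitWeight, shift]

end HistoryLaw

/-! ### The law of the crossing numbers -/

/-- Distinct stopped histories of the same level exclude each other. -/
lemma disjoint_fineEvent {Ω : Type*} {X : ℝ≥0 → Ω → ℕ} {n : ℕ} {γ γ' : List ℕ}
    (h : IsStopped n γ) (h' : IsStopped n γ') (hne : γ ≠ γ') : Disjoint (fineEvent X γ) (fineEvent X γ') := by
  rw [Set.disjoint_left]
  intro ω h1 h2
  obtain ⟨N, ⟨m, hm⟩, ⟨m', hm'⟩⟩ := (h1.and h2).exists
  exact hne (h.eq_of_skelHist h' hm hm')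

lemma JumpHist.mem_fineEvent {Ω : Type*} {X : ℝ≥0 → Ω → ℕ} {ω : Ω} {t : ℝ≥0} {γ : List ℕ}
    (h : JumpHist (fun t => X t ω) t γ) (hx : IsRightCont fun t => X t ω) : ω ∈ fineEvent X γ :=
  h.eventually_skelHist hx mesh_pos tendsto_mesh

section CrossingLaw

variable {Ω : Type*} [MeasurableSpace Ω] {P : Measure Ω} [IsProbabilityMeasure P]
  {X : ℝ≥0 → Ω → ℕ} {b w : ℕ → ℝ} {S : Finset ℕ}

open Classical in
/-- The probability of a stopped history is the one given by the jump chain. The bounds for the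
single histories are equalities, because the stopped histories of level `n`
exhaust the probability space. -/
lemma measure_fineEvent_eq (hbw : IsBranchingData b w) (hX : IsWMBP P b w X)
    (hX0 : ∀ᵐ ω ∂P, X 0 ω = 1) (n : ℕ) (γ : List ℕ) :
    (if IsStopped n γ then P (fineEvent X γ) else 0) = histPMF hbw n γ := by
  obtain ⟨p, hT, hF, hM⟩ := hX.markov
  set d : List ℕ → ℝ≥0∞ := fun γ => if IsStopped n γ then P (fineEvent X γ) else 0 with hd
  have hle : d ≤ histPMF hbw n := fun γ => by
    simp only [hd]
    split_ifs with h
    · exact (measure_fineEvent_le hbw hX.measurable hT hF hM hX0 h.1).trans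
        (histWeight_le_histPMF hbw h)
    · exact zero_le
  have hone : 1 ≤ ∑' γ, d γ := by
    have hcov : ∀ᵐ ω ∂P, ω ∈ ⋃ γ, (if IsStopped n γ then fineEvent X γ else ∅) := by
      filter_upwards [hX.cadlag, ae_not_stuck hbw hT hF hM hX0] with ω h1 h2
      obtain ⟨t, γ, h, hs⟩ := JumpHist.exists_stopped h1.isRightCont h2 n
      refine Set.mem_iUnion.2 ⟨γ, ?_⟩
      rw [if_pos hs]
      exact h.mem_fineEvent h1.isRightCont
    calc (1 : ℝ≥0∞) = P Set.univ := measure_univ.symm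
      _ ≤ P (⋃ γ, (if IsStopped n γ then fineEvent X γ else ∅)) :=
        measure_mono_ae (hcov.mono fun ω h _ => h)
      _ ≤ ∑' γ, P (if IsStopped n γ then fineEvent X γ else ∅) := measure_iUnion_le _
      _ = ∑' γ, d γ := tsum_congr fun γ => by simp only [hd]; split_ifs <;> simp
  by_contra hne
  have hlt : ∑' γ, d γ < ∑' γ, histPMF hbw n γ :=
    ENNReal.tsum_lt_tsum (ne_top_of_le_ne_top ENNReal.one_ne_top
      ((ENNReal.tsum_le_tsum hle).trans (histPMF hbw n).tsum_coe.le)) hle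
      (lt_of_le_of_ne (hle γ) hne)
  rw [PMF.tsum_coe] at hlt
  exact absurd hone (not_le.2 hlt)

/-- The stopped histories of level `n` that end at `0` with crossing numbers `l`. -/
def extinctHist (S : Finset ℕ) (n : ℕ) (l : S → ℕ) : Set (List ℕ) :=
  {γ | IsStopped n γ ∧ γ.headD 0 = 0 ∧ crossCount S γ = l}

lemma extinctHist_mono (l : S → ℕ) : Monotone fun n => extinctHist S n l := by
  refine monotone_nat_of_le_succ fun n γ hγ => ⟨⟨hγ.1.1, hγ.1.2.1.trans (Nat.le_succ _), ?_⟩, hγ.2⟩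
  rcases hγ.1.2.2 with h | h
  · right
    cases γ with
    | nil => simp at h
    | cons a γ => simpa using hγ.2.1
  · exact Or.inr h

lemma measure_biUnion_extinctHist (hbw : IsBranchingData b w) (hX : IsWMBP P b w X)
    (hX0 : ∀ᵐ ω ∂P, X 0 ω = 1) (n : ℕ) (l : S → ℕ) :
    P (⋃ γ ∈ extinctHist S n l, fineEvent X γ) = hitWeight (jumpLaw b) (mark S) n 1 l := by
  classical
  rw [measure_biUnion (Set.to_countable _)
    (fun γ h γ' h' hne => disjoint_fineEvent h.1 h'.1 hne)
    (fun γ _ => measurableSet_fineEvent hX.measurable γ), ← tsum_histPMF_extinct hbw n l,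
    tsum_subtype (extinctHist S n l) fun γ => P (fineEvent X γ)]
  refine tsum_congr fun γ => ?_
  rw [← measure_fineEvent_eq hbw hX hX0 n γ, Set.indicator_apply]
  simp only [extinctHist, Set.mem_ofPred_eq]
  by_cases h1 : IsStopped n γ <;> by_cases h2 : γ.headD 0 = 0 ∧ crossCount S γ = l <;>
    simp [h1, h2]

lemma JumpHist.extinctionTime_eq {x : ℝ≥0 → ℕ} {t : ℝ≥0} {γ : List ℕ} (h : JumpHist x t γ)
    (h0 : 0 ∉ γ.tail) (hx : x t = 0) : extinctionTime x = t := by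
  refine le_antisymm (iInf₂_le (f := fun (t : ℝ≥0) (_ : x t = 0) => (t : ℝ≥0∞)) t hx)
    (le_iInf₂ fun u hu => ENNReal.coe_le_coe.2 ?_)
  by_contra hlt
  exact h0 (hu ▸ h.mem_tail_of_lt u (not_le.1 hlt))

lemma JumpHist.crossingNumber_eq {x : ℝ≥0 → ℕ} {t : ℝ≥0} {γ : List ℕ} (h : JumpHist x t γ)
    (hS1 : 1 ∉ S) (k : S) : crossingNumber x k t = crossCount S γ k := by
  rw [← (h.crossing hS1 k).2]
  simp only [crossingNumber, ENNReal.coe_le_coe]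

/-- Almost surely, extinction with crossing numbers `l` means that some stopped history ends at `0`
with crossing numbers `l`. -/
lemma extinct_ae_iff (hbw : IsBranchingData b w) (hX : IsWMBP P b w X)
    (hX0 : ∀ᵐ ω ∂P, X 0 ω = 1) (hS1 : 1 ∉ S) (l : S → ℕ) :
    ∀ᵐ ω ∂P, (extinctionTime (fun t => X t ω) < ∞ ∧
      ∀ k : S, crossingNumber (fun t => X t ω) k (extinctionTime fun t => X t ω) = l k) ↔
      ω ∈ ⋃ n, ⋃ γ ∈ extinctHist S n l, fineEvent X γ := by
  obtain ⟨p, hT, hF, hM⟩ := hX.markov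
  filter_upwards [hX.cadlag, ae_not_stuck hbw hT hF hM hX0] with ω h1 h2
  simp only [Set.mem_iUnion, exists_prop]
  constructor
  · rintro ⟨hfin, hl⟩
    obtain ⟨t, γ, h, ht, hx⟩ := h1.exists_jumpHist hfin
    have hhead : γ.headD 0 = 0 ∧ γ.head? = some 0 := by
      obtain ⟨γ', rfl⟩ := h.eq_cons
      simpa using hx
    have htail : 0 ∉ γ.tail := by
      intro h0
      obtain ⟨u, hut, hu⟩ := h.exists_of_mem_tail 0 h0
      have : extinctionTime (fun t => X t ω) ≤ u :=
        iInf₂_le (f := fun (t : ℝ≥0) (_ : X t ω = 0) => (t : ℝ≥0∞)) u hu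
      rw [ht, ENNReal.coe_le_coe] at this
      exact absurd hut (not_lt.2 this)
    refine ⟨γ.length, γ, ⟨⟨htail, Nat.le_succ _, Or.inr hhead.2⟩, hhead.1, ?_⟩,
      h.mem_fineEvent h1.isRightCont⟩
    funext k
    rw [← hl k, ht, h.crossingNumber_eq hS1]
  · rintro ⟨n, γ, ⟨hs, hhead, hcount⟩, hmem⟩
    obtain ⟨t, γ', h, hs'⟩ := JumpHist.exists_stopped h1.isRightCont h2 n
    obtain rfl : γ = γ' := by
      by_contra hne
      exact Set.disjoint_left.1 (disjoint_fineEvent hs hs' hne) hmem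
        (h.mem_fineEvent h1.isRightCont)
    have hx : X t ω = 0 := by
      obtain ⟨γ', rfl⟩ := h.eq_cons
      simpa using hhead
    have ht := h.extinctionTime_eq hs.1 hx
    rw [ht]
    exact ⟨ENNReal.coe_lt_top, fun k => by rw [h.crossingNumber_eq hS1, hcount]⟩

/-- The law of the crossing numbers on the event of extinction. -/
lemma measure_extinct_crossing (hbw : IsBranchingData b w) (hX : IsWMBP P b w X)
    (hX0 : ∀ᵐ ω ∂P, X 0 ω = 1) (hS1 : 1 ∉ S) (l : S → ℕ) :
    NullMeasurableSet {ω | extinctionTime (fun t => X t ω) < ∞ ∧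
      ∀ k : S, crossingNumber (fun t => X t ω) k (extinctionTime fun t => X t ω) = l k} P ∧
    P {ω | extinctionTime (fun t => X t ω) < ∞ ∧
      ∀ k : S, crossingNumber (fun t => X t ω) k (extinctionTime fun t => X t ω) = l k} =
      crossWeight b S l := by
  have hae : {ω | extinctionTime (fun t => X t ω) < ∞ ∧
      ∀ k : S, crossingNumber (fun t => X t ω) k (extinctionTime fun t => X t ω) = l k} =ᵐ[P]
      ⋃ n, ⋃ γ ∈ extinctHist S n l, fineEvent X γ :=
    (extinct_ae_iff hbw hX hX0 hS1 l).mono fun ω h => propext h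
  refine ⟨NullMeasurableSet.congr (MeasurableSet.nullMeasurableSet ?_) hae.symm, ?_⟩
  · exact .iUnion fun n => .biUnion (Set.to_countable _) fun γ _ =>
      measurableSet_fineEvent hX.measurable γ
  · rw [measure_congr hae, Monotone.measure_iUnion]
    · simp_rw [measure_biUnion_extinctHist hbw hX hX0]
      rfl
    · exact fun n n' h => Set.biUnion_subset_biUnion_left (extinctHist_mono l h)

end CrossingLaw

end WMB

theorem theorem3p1 {Ω : Type*} [MeasurableSpace Ω] (P : Measure Ω) [IsProbabilityMeasure P]
    (b w : ℕ → ℝ) (hbw : WMB.IsBranchingData b w) (hb0 : 0 < b 0)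
    (S : Finset ℕ) (hS1 : 1 ∉ S) (hSb : ∀ k ∈ S, 0 < b k)
    (X : ℝ≥0 → Ω → ℕ) (hX : WMB.IsWMBP P b w X) (hX0 : ∀ᵐ ω ∂P, X 0 ω = 1)
    (τ : Ω → ℝ≥0∞) (hτ : ∀ ω, τ ω = WMB.extinctionTime fun t => X t ω)
    (Y : S → Ω → ℕ) (hY : ∀ k ω, Y k ω = WMB.crossingNumber (fun t => X t ω) k (τ ω)) :
    ∃ (ρ : ℝ) (r : (S → ℕ) → ℝ),
      WMB.IsMinRoot b ρ ∧ 0 < ρ ∧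
      WMB.IsCrossingCoeff b r ∧ (∀ r', WMB.IsCrossingCoeff b r' → r' = r) ∧
      (∀ v : S → ℝ, (∀ k, v k ∈ Set.Icc (0 : ℝ) 1) →
        Summable (fun l : S → ℕ => r l * ∏ k, v k ^ l k) ∧
        ∫ ω, ∏ k, v k ^ Y k ω ∂(ProbabilityTheory.cond P {ω | τ ω < ∞}) =
          ρ⁻¹ * ∑' l : S → ℕ, r l * ∏ k, v k ^ l k) ∧
      (∀ l : S → ℕ,
        (ProbabilityTheory.cond P {ω | τ ω < ∞}).real {ω | ∀ k, Y k ω = l k} = r l / ρ) := by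
  open WMB in
  obtain rfl : τ = fun ω => extinctionTime fun t => X t ω := funext hτ
  set E : Set Ω := {ω | extinctionTime (fun t => X t ω) < ∞} with hE
  set Z : Ω → S → ℕ := fun ω k => Y k ω with hZ
  -- The paths are càdlàg only almost surely, so the events are null-measurable at best.
  have hlaw : ∀ l : S → ℕ, NullMeasurableSet (E ∩ Z ⁻¹' {l}) P ∧
      P (E ∩ Z ⁻¹' {l}) = crossWeight b S l := by
    intro l
    have hset : E ∩ Z ⁻¹' {l} = {ω | extinctionTime (fun t => X t ω) < ∞ ∧
        ∀ k : S, crossingNumber (fun t => X t ω) k (extinctionTime fun t => X t ω) = l k} := by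
      ext ω
      simp only [hE, hZ, Set.mem_inter_iff, Set.mem_preimage, Set.mem_singleton_iff,
        Set.mem_ofPred_eq, funext_iff, hY]
    rw [hset]
    exact measure_extinct_crossing hbw hX hX0 hS1 l
  have hEU : E = ⋃ l, E ∩ Z ⁻¹' {l} := by
    rw [← Set.inter_iUnion, ← Set.preimage_iUnion, Set.iUnion_of_singleton, Set.preimage_univ,
      Set.inter_univ]
  have hEm : NullMeasurableSet E P := by
    rw [hEU]; exact .iUnion fun l => (hlaw l).1
  have hEP : P E = ∑' l, crossWeight b S l := by
    conv_lhs => rw [hEU]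
    rw [measure_iUnion₀ _ fun l => (hlaw l).1]
    · exact tsum_congr fun l => (hlaw l).2
    · intro l l' hne
      exact (Set.disjoint_left.2 fun ω h1 h2 => hne (h1.2.symm.trans h2.2)).aedisjoint
  have hle1 := tsum_crossWeight_le_one (S := S) hbw
  have htop : ∑' l, crossWeight b S l ≠ ∞ := ne_top_of_le_ne_top ENNReal.one_ne_top hle1
  have hne0 := tsum_crossWeight_ne_zero (S := S) hbw hb0
  set ρ : ℝ := (∑' l, crossWeight b S l).toReal with hρ
  set r : (S → ℕ) → ℝ := fun l => (crossWeight b S l).toReal with hr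
  have hρ0 : 0 < ρ := ENNReal.toReal_pos hne0 htop
  have hrs : Summable r := (ENNReal.hasSum_toReal htop).summable
  have hr0 : ∀ l, 0 ≤ r l := fun l => ENNReal.toReal_nonneg
  have hcoeff := isCrossingCoeff_crossWeight hbw hS1 hSb
  have hcond : ∀ l : S → ℕ,
      (ProbabilityTheory.cond P E).real (Z ⁻¹' {l}) = r l / ρ := by
    intro l
    rw [measureReal_def, ProbabilityTheory.cond, Measure.smul_apply, smul_eq_mul,
      Measure.restrict_apply₀' hEm, Set.inter_comm, (hlaw l).2, hEP, ENNReal.toReal_mul,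
      ENNReal.toReal_inv, mul_comm, div_eq_mul_inv]
  have hZm : AEMeasurable Z (ProbabilityTheory.cond P E) := by
    refine NullMeasurable.aemeasurable fun A _ => ?_
    have hA : Z ⁻¹' A ∩ E = ⋃ l ∈ A, E ∩ Z ⁻¹' {l} := by
      ext ω; simp [and_comm]
    have h1 : NullMeasurableSet (Z ⁻¹' A ∩ E) P := by
      rw [hA]; exact .biUnion A.to_countable fun l _ => (hlaw l).1
    have h2 : NullMeasurableSet (Z ⁻¹' A) (P.restrict E) :=
      (nullMeasurableSet_restrict hEm).2 h1
    exact h2.smul_measure _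
  have hprob : IsProbabilityMeasure (ProbabilityTheory.cond P E) :=
    ProbabilityTheory.cond_isProbabilityMeasure (by rw [hEP]; exact hne0)
  refine ⟨ρ, r, tsum_crossWeight_isMinRoot hbw, hρ0, hcoeff, fun r' h' => h'.unique hcoeff,
    fun v hv => ?_, fun l => ?_⟩
  · have hv0 : ∀ l : S → ℕ, 0 ≤ ∏ k, v k ^ l k := fun l =>
      Finset.prod_nonneg fun k _ => pow_nonneg (hv k).1 _
    have hv1 : ∀ l : S → ℕ, ∏ k, v k ^ l k ≤ 1 := fun l =>
      Finset.prod_le_one (fun k _ => pow_nonneg (hv k).1 _)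
        fun k _ => pow_le_one₀ (hv k).1 (hv k).2
    refine ⟨Summable.of_nonneg_of_le (fun l => mul_nonneg (hr0 l) (hv0 l))
      (fun l => mul_le_of_le_one_right (hr0 l) (hv1 l)) hrs, ?_⟩
    have hprob' : IsProbabilityMeasure ((ProbabilityTheory.cond P E).map Z) :=
      Measure.isProbabilityMeasure_map hZm
    have hmeas : Measurable fun l : S → ℕ => ∏ k, v k ^ l k := measurable_of_countable _
    have hint : Integrable (fun l : S → ℕ => ∏ k, v k ^ l k)
        ((ProbabilityTheory.cond P E).map Z) := by
      refine Integrable.of_bound hmeas.aestronglyMeasurable 1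
        (Filter.Eventually.of_forall fun l => ?_)
      rw [Real.norm_eq_abs, abs_of_nonneg (hv0 l)]
      exact hv1 l
    calc ∫ ω, ∏ k, v k ^ Y k ω ∂(ProbabilityTheory.cond P E)
        = ∫ l, ∏ k, v k ^ l k ∂((ProbabilityTheory.cond P E).map Z) :=
          (integral_map hZm hmeas.aestronglyMeasurable).symm
      _ = ∑' l : S → ℕ, ρ⁻¹ * (r l * ∏ k, v k ^ l k) := by
          rw [integral_countable hint]
          refine tsum_congr fun l => ?_
          rw [measureReal_def, Measure.map_apply_of_aemeasurable hZm (measurableSet_singleton l),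
            ← measureReal_def, hcond l, smul_eq_mul, div_eq_mul_inv]
          ring
      _ = _ := tsum_mul_left
  · rw [← hcond l]
    congr 1
    ext ω
    simp only [hZ, Set.mem_preimage, Set.mem_singleton_iff, funext_iff]
    rfl
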